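/- Notation. For $m\in\mathbb N$ let $\mathcal S_m$ be the symmetric group, and for a partition $\lambda=(\lambda_1\ge\dots\ge\lambda_\ell>0)$ of $m$ let $V_\lambda$ be the simple $\mathbb Q[\mathcal S_m]$-module attached to $\lambda$, $\chi_{V_\lambda}$ its character, and $\mathbf w(\lambda):=\lambda_2+\dots+\lambda_\ell$ its weight. Representations are over $\mathbb Q$ and finite dimensional; the weight $\mathbf w(W_m)$ of a representation $W_m=\bigoplus_{\lambda\vdash m}V_\lambda^{n_\lambda}$ of $\mathcal S_m$ is $\sup\{\mathbf w(\lambda)\mid n_\lambda\ne0\}$ (and $0$ if $W_m=0$). On $\mathbb Q[\bar X]=\mathbb Q[X_1,X_2,\dots]$ let $\deg_{\mathbf w}$ be the weighted degree with $\deg_{\mathbf w}(X_i)=i$, called weight (the zero polynomial has weight $0$), and let $\mathbb Q^{\le d}[\bar X]$ be the space of polynomials of weight $\le d$. Let $\rho_m$ be the algebra homomorphism from $\mathbb Q[\bar X]$ to the functions on $\mathcal S_m$ sending $X_i$ to the class function $g\mapsto X_i(g)$, the number of $i$-cycles of $g$. For functions on $\mathcal S_m$ put $\langle f_1|f_2\rangle_{\mathcal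 S_m}=\frac1{|\mathcal S_m|}\sum_g f_1(g)f_2(g^{-1})$; polynomials are read as functions through $\rho_m$. The Frobenius polynomial $\mathbf X_\lambda\in\mathbb Q[\bar X]$ is the coefficient of $y_1^{\lambda_1+\ell-1}y_2^{\lambda_2+\ell-2}\cdots y_\ell^{\lambda_\ell}$ in $\prod_{i<j}(y_i-y_j)\prod_{d\ge1}(y_1^d+\dots+y_\ell^d)^{X_d}$, that is (putting $y_1=1$, which loses nothing by homogeneity) the coefficient of $y_2^{\lambda_2+\ell-2}\cdots y_\ell^{\lambda_\ell}$ in $\prod_{2\le i<j}(y_i-y_j)\prod_{j\ge2}(1-y_j)\prod_{d\ge1}\sum_{k\ge0}\binom{X_d}{k}(y_2^d+\dots+y_\ell^d)^k$. Theorem. (a) For $d,m\in\mathbb N$ let $\rho_{m|d}$ be the restriction of $\rho_m$ to $\mathbb Q^{\le d}[\bar X]$. Its image is the $\mathbb Q$-span of the characters $\chi_{V_\lambda}$ with $\lambda\vdash m$ and $\mathbf w(\lambda)\le d$; and $\ker(\rho_{m|d})=0$ if and only if $d\le m/2$. (b) Let $P\in\mathbb Q[\bar X]$. (i) The scalar product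 $\langle1|P\rangle_{\mathcal S_m}$ is constant for $m\ge\deg_{\mathbf w}(P)$. (ii) $\langle\chi_{V_\lambda}|P\rangle_{\mathcal S_m}=0$ for every $m$ and every $\lambda\vdash m$ such that $\mathbf w(\lambda)>\deg_{\mathbf w}(P)$. (iii) If $W_m$ is a representation of $\mathcal S_m$ and $\rho_m(P)=\chi_{W_m}$, then $\deg_{\mathbf w}(P)\ge\mathbf w(W_m)$. (c) Let $W_m=\bigoplus_{\lambda\vdash m}V_\lambda^{n_\lambda}$ be a representation of $\mathcal S_m$. The polynomial $\mathbf X_{W_m}:=\sum_{\lambda\vdash m}n_\lambda\mathbf X_\lambda$ belongs to $\mathbb Q[X_1,\dots,X_{m-1}]$ and verifies $\rho_m(\mathbf X_{W_m})=\chi_{W_m}$ and $\deg_{\mathbf w}(\mathbf X_{W_m})=\mathbf w(W_m)$; and it is the only polynomial verifying simultaneously these two equalities if and only if $\mathbf w(W_m)\le m/2$. -/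

import Mathlib

open MvPolynomial

universe u

noncomputable section

namespace SymChar

/-! ### Partitions -/

/-- The parts `λ₁ ≥ λ₂ ≥ ⋯ ≥ λ_ℓ > 0` of a partition, in decreasing order. -/
def rows {m : ℕ} (lam : m.Partition) : List ℕ := lam.parts.sort (· ≥ ·)

/-- The weight `w(λ) = λ₂ + ⋯ + λ_ℓ` of a partition. -/
def weight {m : ℕ} (lam : m.Partition) : ℕ := (rows lam).tail.sum

theorem sum_rows {m : ℕ} (lam : m.Partition) :
    ∑ i : Fin (rows lam).length, (rows lam)[i] = m := by
  have h : (rows lam).sum = m := by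
    rw [← Multiset.sum_coe, rows, Multiset.sort_eq, lam.parts_sum]
  simpa using h

/-! ### The simple modules `V_λ`, through Young symmetrizers -/

/-- The tableau of shape `λ` whose boxes are numbered row by row: it sends an entry to its box,
given as a pair (row, position in the row). -/
def tableau {m : ℕ} (lam : m.Partition) :
    Fin m ≃ (i : Fin (rows lam).length) × Fin ((rows lam)[i]) :=
  (finCongr (sum_rows lam).symm).trans finSigmaFinEquiv.symm

/-- The row of an entry. -/
def row {m : ℕ} (lam : m.Partition) (k : Fin m) : ℕ := (tableau lam k).1

/-- The column of an entry. -/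
def col {m : ℕ} (lam : m.Partition) (k : Fin m) : ℕ := (tableau lam k).2

/-- The Young symmetrizer `c_λ = a_λ b_λ`, where `a_λ` is the sum of the permutations preserving
each row, and `b_λ` the signed sum of the permutations preserving each column. -/
def youngSymmetrizer {m : ℕ} (lam : m.Partition) : MonoidAlgebra ℚ (Equiv.Perm (Fin m)) :=
  (∑ g : Equiv.Perm (Fin m) with ∀ k, row lam (g k) = row lam k, MonoidAlgebra.single g (1 : ℚ)) *
  (∑ g : Equiv.Perm (Fin m) with ∀ k, col lam (g k) = col lam k,
    MonoidAlgebra.single g (((Equiv.Perm.sign g : ℤ) : ℚ)))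

/-- The simple module `V_λ`: the left ideal of the group algebra generated by `c_λ`. -/
def simpleModule {m : ℕ} (lam : m.Partition) :
    Submodule (MonoidAlgebra ℚ (Equiv.Perm (Fin m))) (MonoidAlgebra ℚ (Equiv.Perm (Fin m))) :=
  Submodule.span _ {youngSymmetrizer lam}

/-- `V_λ` as a representation: `S_m` acts by multiplication on the left. -/
def simpleRep {m : ℕ} (lam : m.Partition) :
    Representation ℚ (Equiv.Perm (Fin m)) (simpleModule lam) :=
  Representation.ofModule' (simpleModule lam)

/-- The character `χ_{V_λ}`. -/
def simpleChar {m : ℕ} (lam : m.Partition) : Equiv.Perm (Fin m) → ℚ :=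
  (simpleRep lam).character

/-! ### Multiplicities and weight of a representation -/

section Rep

variable {m : ℕ} {W : Type u} [AddCommGroup W] [Module ℚ W]

/-- The multiplicity `n_λ` of `V_λ` in `W`: the dimension of the space of equivariant maps
from `V_λ` to `W`. -/
def multiplicity (r : Representation ℚ (Equiv.Perm (Fin m)) W) (lam : m.Partition) : ℕ :=
  Module.finrank ℚ ((simpleRep lam).IntertwiningMap r)

/-- The weight `w(W)`: the greatest weight of a partition `λ` such that `V_λ` occurs in `W`
(and `0` if `W = 0`). -/
def repWeight (r : Representation ℚ (Equiv.Perm (Fin m)) W) : ℕ :=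
  {lam : m.Partition | multiplicity r lam ≠ 0}.toFinset.sup weight

end Rep

/-! ### Polynomials in the cycle counts -/

/-- The ring `ℚ[X₁, X₂, …]`. -/
abbrev CyclePoly : Type := MvPolynomial ℕ+ ℚ

/-- The weight of a polynomial: the weighted degree with `deg X_i = i` (and `0` for `P = 0`). -/
def polyWeight (P : CyclePoly) : ℕ := weightedTotalDegree (fun i : ℕ+ => (i : ℕ)) P

/-- The number of `i`-cycles of `g` (fixed points if `i = 1`). -/
def cycleCount (m : ℕ) (i : ℕ+) (g : Equiv.Perm (Fin m)) : ℕ := g.partition.parts.count (i : ℕ)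

/-- The algebra homomorphism `ρ_m`, which sends `X_i` to the function counting `i`-cycles. -/
def rho (m : ℕ) : CyclePoly →ₐ[ℚ] (Equiv.Perm (Fin m) → ℚ) :=
  aeval fun i g => (cycleCount m i g : ℚ)

/-- The space of polynomials of weight at most `d`: all monomials have weight at most `d`. -/
def polyLE (d : ℕ) : Submodule ℚ CyclePoly :=
  restrictSupport ℚ {s : ℕ+ →₀ ℕ | Finsupp.weight (fun i : ℕ+ => (i : ℕ)) s ≤ d}

/-- The restriction of `ρ_m` to the polynomials of weight at most `d`. -/
def rhoLE (m d : ℕ) : polyLE d →ₗ[ℚ] (Equiv.Perm (Fin m) → ℚ) :=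
  (rho m).toLinearMap.domRestrict (polyLE d)

/-- The scalar product `⟨f₁|f₂⟩ = |S_m|⁻¹ ∑ f₁(g) f₂(g⁻¹)`. -/
def scalarProd {m : ℕ} (f₁ f₂ : Equiv.Perm (Fin m) → ℚ) : ℚ :=
  (Fintype.card (Equiv.Perm (Fin m)) : ℚ)⁻¹ * ∑ g, f₁ g * f₂ g⁻¹

/-! ### Frobenius polynomials -/

section Frobenius

variable {m : ℕ} (lam : m.Partition)

/-- Polynomials in variables `y₁, …, y_ℓ`, with coefficients in `ℚ[X₁, X₂, …]`. -/
abbrev YPoly : Type := MvPolynomial (Fin (rows lam).length) CyclePoly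

/-- The variables `y₁, …, y_ℓ`, specialized at `y₁ = 1`. -/
def yVar (i : Fin (rows lam).length) : YPoly lam := if (i : ℕ) = 0 then 1 else X i

/-- The discriminant `Δ(y) = ∏_{i<j} (y_i - y_j)`, at `y₁ = 1`. -/
def discr : YPoly lam := ∏ i, ∏ j ∈ Finset.Ioi i, (yVar lam i - yVar lam j)

/-- The power sum `P_d(y) = y₁^d + ⋯ + y_ℓ^d`, at `y₁ = 1`. -/
def powerSum (d : ℕ) : YPoly lam := ∑ i, yVar lam i ^ d

/-- The binomial coefficient `X_d (X_d - 1) ⋯ (X_d - j + 1) / j!`. -/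
def binomX (d : ℕ+) (j : ℕ) : CyclePoly :=
  C ((j.factorial : ℚ)⁻¹) * ∏ t ∈ Finset.range j, (X d - C (t : ℚ))

/-- The power `P_d(y)^{X_d}` with indeterminate exponent, at `y₁ = 1`: the binomial expansion
`∑_j binom(X_d, j) (P_d(y) - 1)^j`, truncated at `j ≤ m`. The series `P_d(y) - 1` has order at
least `d`, so that the terms left out have order greater than `m` in `y₂, …, y_ℓ`. -/
def powerSumPow (d : ℕ+) : YPoly lam :=
  ∑ j ∈ Finset.range (m + 1), C (binomX d j) * (powerSum lam d - 1) ^ j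

/-- The exponent of `y₁^{λ₁+ℓ-1} y₂^{λ₂+ℓ-2} ⋯ y_ℓ^{λ_ℓ}`, at `y₁ = 1`. -/
def frobExponent : Fin (rows lam).length →₀ ℕ :=
  Finsupp.equivFunOnFinite.symm fun i =>
    if (i : ℕ) = 0 then 0 else (rows lam)[i] + ((rows lam).length - 1 - i)

/-- The Frobenius polynomial `X_λ`: the coefficient of `y₁^{λ₁+ℓ-1} y₂^{λ₂+ℓ-2} ⋯ y_ℓ^{λ_ℓ}` in
`Δ(y) ∏_{d ≥ 1} P_d(y)^{X_d}`. Both the monomial and, for the values of the `X_d` at an element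
of `S_m`, the product are homogeneous of the same degree, so that one may put `y₁ = 1`. Then
`Δ(y)` has order `(ℓ-2) + (ℓ-3) + ⋯` in `y₂, …, y_ℓ`, so that only terms of order at most
`λ₂ + ⋯ + λ_ℓ ≤ m` of the powers contribute to this coefficient, and the factors with `d > m`
contribute only `1`. -/
def frobPoly : CyclePoly :=
  coeff (frobExponent lam)
    (discr lam * ∏ d ∈ Finset.range m, powerSumPow lam d.succPNat)

end Frobenius

/-- The Frobenius polynomial `X_W = ∑_λ n_λ X_λ` of a representation. -/
def repFrobPoly {m : ℕ} {W : Type u} [AddCommGroup W] [Module ℚ W]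
    (r : Representation ℚ (Equiv.Perm (Fin m)) W) : CyclePoly :=
  ∑ lam : m.Partition, multiplicity r lam • frobPoly lam

end SymChar

end

noncomputable section

namespace SymChar

open Finset

/-! The proof rests on two properties of the Frobenius polynomial of `λ ⊢ m`: its weight is at most
`w(λ)`, and `ρ_m` sends it to `χ_λ`. The weight bound compares degrees: at `y₁ = 1` the coefficient
`binom(X_d, j)`, of weight `jd`, multiplies `(P_d - 1)^j`, of order at least `jd`
(`frobPoly_mem_polyLE`).

The value is Frobenius' character formula (`simpleChar_eq_frobChar`). Let `F_λ` be the function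
given by the coefficient in question. Then `⟨F_λ|F_λ⟩ = 1`, by the Cauchy kernel and the
Jacobi–Trudi identity (`sum_frobChar_sq`); `⟨χ_λ|χ_λ⟩ = 1`, since Young symmetrizers force the
equivariant endomorphisms of `V_λ` to be scalars (`finrank_intertwiningMap`); and `⟨χ_λ|F_λ⟩ = 1`,
since `F_λ` is an alternating sum of permutation characters of which `χ_λ` meets only the leading
one, once (`scalarProd_frobChar`). Hence `χ_λ - F_λ` has norm zero. The same triangularity makes the
`χ_λ` orthonormal.

Removing the first row injects the partitions of `m` of weight at most `d` into the monomials of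
weight at most `d`, and this is a bijection exactly when `2d ≤ m`. In that case the Frobenius
polynomials, independent because the characters are, form a basis of the polynomials of weight at
most `d` (`span_frobPoly_eq`).

For (b), expand `P` in such a basis for a large `M ≥ m`. In `S_m` each basis element becomes a
combination, with coefficients independent of `m`, of permutation characters on words in which one
letter occurs at least `m - deg P` times. Each such character pairs to `1` with the trivial one, and
to `0` with `χ_λ` if `w(λ) > deg P`, since a letter occurs at most `λ₁ = m - w(λ)` times in a
column-injective word. Parts (a) and (c) follow by counting dimensions. -/

theorem comp_inv_eq_iff {ι : Type*} {m : ℕ} (f : Fin m → ι) (g : Equiv.Perm (Fin m)) :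
    f ∘ ⇑g⁻¹ = f ↔ f ∘ g = f := by
  constructor <;> intro h <;> nth_rw 1 [← h] <;> ext <;> simp

/-! ### Words, their contents and permutation characters -/

section Words

variable {ι : Type*} [DecidableEq ι] {m : ℕ}

/-- The number of occurrences of each letter in a word. -/
def content (f : Fin m → ι) (i : ι) : ℕ := #{k | f k = i}

theorem content_comp (f : Fin m → ι) (g : Equiv.Perm (Fin m)) : content (f ∘ g) = content f := by
  ext i
  exact Finset.card_equiv g (by simp)

theorem exists_comp_perm_of_content_eq {f f' : Fin m → ι} (h : content f = content f') :
    ∃ g : Equiv.Perm (Fin m), f ∘ g = f' := by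
  have e : ∀ i, Nonempty ({k // f' k = i} ≃ {k // f k = i}) := fun i => by
    refine ⟨Fintype.equivOfCardEq ?_⟩
    have := congrFun h i
    simpa [content, Fintype.card_subtype] using this.symm
  replace e := fun i => (e i).some
  refine ⟨(Equiv.sigmaFiberEquiv f').symm.trans
    ((Equiv.sigmaCongrRight e).trans (Equiv.sigmaFiberEquiv f)), ?_⟩
  ext k
  exact (e (f' k) ⟨k, rfl⟩).2

variable [Fintype ι]

theorem sum_content (f : Fin m → ι) : ∑ i, content f i = m := by
  have := Finset.card_eq_sum_card_fiberwise (f := f) (s := univ) (t := univ) (by simp)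
  simpa [content] using this.symm

theorem exists_word (c : ι → ℕ) (hc : ∑ i, c i = m) : ∃ f : Fin m → ι, content f = c := by
  have h : Fintype.card (Fin m) = Fintype.card ((i : ι) × Fin (c i)) := by simp [hc]
  let e := Fintype.equivOfCardEq h
  refine ⟨fun k => (e k).1, funext fun i => ?_⟩
  have : #{p : (i : ι) × Fin (c i) | p.1 = i} = c i := by
    rw [← Fintype.card_subtype, Fintype.card_congr (Equiv.sigmaSubtype i)]
    simp
  rw [← this]
  exact Finset.card_equiv e (by simp)

/-- Orbit-stabilizer, for the words with a given content. -/
theorem sum_card_stabilizer (c : ι → ℕ) (hc : ∑ i, c i = m) :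
    ∑ f : Fin m → ι with content f = c, #{g : Equiv.Perm (Fin m) | f ∘ g = f} = m.factorial := by
  obtain ⟨f₀, h₀⟩ := exists_word c hc
  have h1 : Fintype.card (Equiv.Perm (Fin m)) = m.factorial := by
    simp [Fintype.card_perm]
  rw [← h1, ← Finset.card_univ, Finset.card_eq_sum_card_fiberwise
    (f := fun g : Equiv.Perm (Fin m) => f₀ ∘ g) (t := ({f : Fin m → ι | content f = c} : Finset _))]
  · refine Finset.sum_congr rfl fun f hf => ?_
    obtain ⟨g₀, rfl⟩ := exists_comp_perm_of_content_eq (h₀.trans (mem_filter.1 hf).2.symm)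
    -- Left translation by `g₀` carries the stabilizer of `f₀ ∘ g₀` onto the coset of permutations
    -- that send `f₀` to `f₀ ∘ g₀`.
    refine Finset.card_equiv (Equiv.mulLeft g₀) fun g => ?_
    simp [Function.comp_assoc]
  · intro g _
    simp [content_comp, h₀]

/-- Burnside counting: after exchanging the sums, each word is weighted by the size of its
stabilizer, and these sizes add up to `m!` over each content. -/
theorem sum_sum_fixed {M : Type*} [AddCommMonoid M] (Φ : (ι → ℕ) → M) :
    ∑ g : Equiv.Perm (Fin m), ∑ f : Fin m → ι with f ∘ g = f, Φ (content f) =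
      m.factorial • ∑ c ∈ piAntidiag univ m, Φ c := by
  simp_rw [Finset.sum_filter]
  rw [Finset.sum_comm, ← Finset.sum_fiberwise_of_maps_to
    (g := content) (t := piAntidiag univ m) (by simp [sum_content]), Finset.smul_sum]
  refine Finset.sum_congr rfl fun c hc => ?_
  rw [← sum_card_stabilizer c (by simpa using hc), Finset.sum_smul]
  refine Finset.sum_congr rfl fun f hf => ?_
  rw [← Finset.sum_filter, (mem_filter.1 hf).2, Finset.sum_const]

/-- The number of words of content `c` that are constant on the cycles of `g`: the character of the
permutation representation attached to `c`. -/
def permChar (c : ι → ℕ) (g : Equiv.Perm (Fin m)) : ℚ :=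
  #{f : Fin m → ι | f ∘ g = f ∧ content f = c}

theorem permChar_inv (c : ι → ℕ) (g : Equiv.Perm (Fin m)) : permChar c g⁻¹ = permChar c g := by
  simp only [permChar, comp_inv_eq_iff]

theorem prod_comp_word {R : Type*} [CommMonoid R] (y : ι → R) (f : Fin m → ι) :
    ∏ k, y (f k) = ∏ i, y i ^ content f i := by
  rw [← Finset.prod_fiberwise univ f]
  refine Finset.prod_congr rfl fun i _ => ?_
  rw [content, ← Finset.prod_const]
  exact Finset.prod_congr rfl fun k hk => by rw [(mem_filter.1 hk).2]

end Words

/-! ### Cycles of a permutation and power sums -/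

section Cycles

variable {α : Type*} [Fintype α]

/-- The cycles of a permutation, fixed points included, as a type. -/
abbrev Cycles (g : Equiv.Perm α) : Type _ := Quotient (Equiv.Perm.SameCycle.setoid g)

instance (g : Equiv.Perm α) : DecidableEq (Cycles g) := Classical.decEq _

instance (g : Equiv.Perm α) : Fintype (Cycles g) := Fintype.ofFinite _

theorem card_cycle_of_fixed (g : Equiv.Perm α) (x : α) (hx : g x = x) :
    #{k : α | (Quotient.mk (Equiv.Perm.SameCycle.setoid g) k) = ⟦x⟧} = 1 := by
  rw [card_eq_one]
  refine ⟨x, ?_⟩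
  ext k
  rw [mem_filter, Quotient.eq, mem_singleton]
  simp only [mem_univ, true_and]
  refine ⟨fun h => ?_, fun h => h ▸ Equiv.Perm.SameCycle.refl g k⟩
  obtain ⟨i, hi⟩ := Equiv.Perm.SameCycle.symm h
  rw [← hi]
  exact Equiv.Perm.zpow_apply_eq_self_of_apply_eq_self hx i

variable [DecidableEq α]

theorem card_cycle (g : Equiv.Perm α) (x : α) (hx : g x ≠ x) :
    #{k : α | (Quotient.mk (Equiv.Perm.SameCycle.setoid g) k) = ⟦x⟧} = #(g.cycleOf x).support := by
  congr 1
  ext k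
  rw [mem_filter, Equiv.Perm.mem_support_cycleOf_iff, Quotient.eq]
  simp only [mem_univ, true_and, Equiv.Perm.mem_support]
  exact ⟨fun h => ⟨Equiv.Perm.SameCycle.symm h, hx⟩, fun h => h.1.symm⟩

/-- The partition of `g` lists the nontrivial cycles and one part `1` per fixed point; the classes
of `SameCycle` are split in the same way and matched separately. -/
theorem prod_parts_partition {R : Type*} [CommMonoid R] (g : Equiv.Perm α) (P : ℕ → R) :
    (g.partition.parts.map P).prod =
      ∏ w : Cycles g, P #{k : α | (Quotient.mk (Equiv.Perm.SameCycle.setoid g) k) = w} := by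
  rw [Equiv.Perm.parts_partition, Multiset.map_add, Multiset.prod_add, Multiset.map_replicate,
    Multiset.prod_replicate, Equiv.Perm.cycleType_def, Multiset.map_map,
    ← Finset.prod_filter_mul_prod_filter_not univ (fun w : Cycles g => ∃ x, g x ≠ x ∧ ⟦x⟧ = w)]
  have hne : ∀ c ∈ g.cycleFactorsFinset, ∃ x, x ∈ c.support := fun c hc =>
    (Equiv.Perm.mem_cycleFactorsFinset_iff.1 hc).1.nonempty_support
  have hmem : ∀ c ∈ g.cycleFactorsFinset, ∀ x ∈ c.support, g x ≠ x := fun c hc x hx =>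
    Equiv.Perm.mem_support.1 (Equiv.Perm.mem_cycleFactorsFinset_support_le hc hx)
  congr 1
  · refine Finset.prod_bij (fun c hc => ⟦(hne c hc).choose⟧) ?_ ?_ ?_ ?_
    · intro c hc
      simp only [mem_filter, mem_univ, true_and]
      exact ⟨_, hmem c hc _ (hne c hc).choose_spec, rfl⟩
    · intro c hc c' hc' h
      rw [Equiv.Perm.cycle_is_cycleOf (hne c hc).choose_spec hc,
        Equiv.Perm.cycle_is_cycleOf (hne c' hc').choose_spec hc']
      exact Equiv.Perm.SameCycle.cycleOf_eq (Quotient.exact h)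
    · intro w hw
      obtain ⟨x, hx, rfl⟩ := (mem_filter.1 hw).2
      have hc := Equiv.Perm.cycleOf_mem_cycleFactorsFinset_iff.2 (Equiv.Perm.mem_support.2 hx)
      refine ⟨g.cycleOf x, hc, Quotient.sound ?_⟩
      exact ((Equiv.Perm.mem_support_cycleOf_iff.1 (hne _ hc).choose_spec).1).symm
    · intro c hc
      rw [card_cycle g _ (hmem c hc _ (hne c hc).choose_spec),
        ← Equiv.Perm.cycle_is_cycleOf (hne c hc).choose_spec hc]
      rfl
  · rw [← Finset.card_compl, ← Finset.prod_const]
    refine Finset.prod_bij (fun x _ => ⟦x⟧) ?_ ?_ ?_ ?_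
    · intro x hx
      simp only [mem_compl, Equiv.Perm.mem_support, not_not] at hx
      simp only [mem_filter, mem_univ, true_and]
      rintro ⟨z, hz, h⟩
      exact hz ((Equiv.Perm.SameCycle.apply_eq_self_iff (Quotient.exact h)).2 hx)
    · intro x hx z hz h
      simp only [mem_compl, Equiv.Perm.mem_support, not_not] at hx
      obtain ⟨i, rfl⟩ := Quotient.exact h
      exact (Equiv.Perm.zpow_apply_eq_self_of_apply_eq_self hx i).symm
    · intro w hw
      induction w using Quotient.inductionOn with | _ x
      simp only [mem_filter, mem_univ, true_and, not_exists, not_and'] at hw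
      exact ⟨x, by simpa using hw x rfl, rfl⟩
    · intro x hx
      simp only [mem_compl, Equiv.Perm.mem_support, not_not] at hx
      rw [card_cycle_of_fixed g x hx]

/-- A word fixed by `g` is a choice of one letter per cycle, and a cycle of length `d` with letter
`i` contributes `y i ^ d`. Expanding the product of power sums enumerates these choices. -/
theorem sum_fixed_prod {ι R : Type*} [Fintype ι] [DecidableEq ι] [CommSemiring R] (g : Equiv.Perm α)
    (y : ι → R) :
    ∑ f : α → ι with f ∘ g = f, ∏ k, y (f k) =
      (g.partition.parts.map fun d => ∑ i, y i ^ d).prod := by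
  rw [prod_parts_partition, Finset.prod_univ_sum]
  symm
  refine Finset.sum_bij (fun F _ => fun k => F ⟦k⟧) ?_ ?_ ?_ ?_
  · intro F _
    simp only [mem_filter, mem_univ, true_and]
    ext k
    have : (⟦g k⟧ : Cycles g) = ⟦k⟧ :=
      Quotient.sound (Equiv.Perm.sameCycle_apply_left.2 (Equiv.Perm.SameCycle.refl g k))
    simp [this]
  · intro F _ F' _ h
    ext w
    induction w using Quotient.inductionOn with | _ k => exact congrFun h k
  · intro f hf
    have hf := (mem_filter.1 hf).2
    have h1 : ∀ (n : ℕ) k, f ((g ^ n) k) = f k := by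
      intro n
      induction n with
      | zero => simp
      | succ n ih =>
        intro k
        rw [pow_succ', Equiv.Perm.mul_apply]
        exact (congrFun hf _).trans (ih k)
    refine ⟨Quotient.lift f fun a b (h : g.SameCycle a b) => ?_, by simp, rfl⟩
    obtain ⟨n, -, -, rfl⟩ := h.exists_pow_eq g
    exact (h1 n a).symm
  · intro F _
    rw [← Finset.prod_fiberwise univ (fun k => (⟦k⟧ : Cycles g))]
    refine Finset.prod_congr rfl fun w _ => ?_
    rw [← Finset.prod_const]
    exact Finset.prod_congr rfl fun k hk => by rw [← (mem_filter.1 hk).2]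

end Cycles

/-! ### The Jacobi–Trudi identity -/

section JacobiTrudi

variable {R : Type*} [CommRing R] {n : ℕ} (y : Fin n → R)

/-- The complete homogeneous symmetric polynomial of degree `r` in the entries of `y`. -/
def complete (r : ℕ) : R := ∑ c ∈ piAntidiag univ r, ∏ i, y i ^ c i

/-- The complete homogeneous symmetric polynomial of degree `a - r`, which is `0` for `a < r`. -/
def completeSub (a r : ℕ) : R := if r ≤ a then complete y (a - r) else 0

theorem complete_zero : complete y 0 = 1 := by
  simp [complete]

theorem mk_complete : PowerSeries.mk (complete y) = ∏ i, PowerSeries.mk fun k => y i ^ k := by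
  ext r
  rw [PowerSeries.coeff_mk, PowerSeries.coeff_prod, complete]
  refine Finset.sum_equiv Finsupp.equivFunOnFinite.symm (fun c => ?_) (fun c _ => ?_)
  · simp [mem_finsuppAntidiag]
  · simp

theorem mk_pow_mul (z : R) :
    PowerSeries.mk (fun k => z ^ k) * (1 - PowerSeries.C z * PowerSeries.X) = 1 := by
  ext (_ | k)
  · simp [mul_sub]
  · rw [mul_sub, ← mul_assoc, map_sub, PowerSeries.coeff_succ_mul_X]
    simp [pow_succ]

/-- The product of the `1 - y_l t` with `l ≠ k`. -/
def coFactor (k : Fin n) : Polynomial R :=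
  ∏ l ∈ univ.erase k, (1 - Polynomial.C (y l) * Polynomial.X)

theorem coeff_coFactor_eq_zero (k : Fin n) {r : ℕ} (hr : n ≤ r) : (coFactor y k).coeff r = 0 := by
  refine Polynomial.coeff_eq_zero_of_natDegree_lt (lt_of_le_of_lt ?_ (lt_of_lt_of_le
    (show n - 1 < n from Nat.sub_lt (k.pos) one_pos) hr))
  refine (Polynomial.natDegree_prod_le _ _).trans ?_
  refine (Finset.sum_le_card_nsmul _ _ 1 fun l _ => ?_).trans (by simp)
  refine (Polynomial.natDegree_sub_le _ _).trans ?_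
  simpa using (Polynomial.natDegree_C_mul_le (y l) Polynomial.X).trans Polynomial.natDegree_X_le

/-- The generating series of the complete polynomials is `∏ 1 / (1 - y_l t)`; the cofactor cancels
every factor but the one of `y_k`. -/
theorem mk_complete_mul_coFactor (k : Fin n) :
    PowerSeries.mk (complete y) * (coFactor y k : PowerSeries R) =
      PowerSeries.mk fun r => y k ^ r := by
  have h : (coFactor y k : PowerSeries R) =
      ∏ l ∈ univ.erase k, (1 - PowerSeries.C (y l) * PowerSeries.X) := by
    rw [coFactor, ← Polynomial.coeToPowerSeries.ringHom_apply, map_prod]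
    simp
  rw [h, mk_complete, ← Finset.mul_prod_erase univ _ (mem_univ k), mul_assoc,
    ← Finset.prod_mul_distrib]
  simp [mk_pow_mul]

theorem sum_completeSub_mul (a : ℕ) (k : Fin n) :
    ∑ j : Fin n, completeSub y a j.rev * (coFactor y k).coeff j.rev = y k ^ a := by
  have h := congrArg (PowerSeries.coeff a) (mk_complete_mul_coFactor y k)
  rw [PowerSeries.coeff_mk, PowerSeries.coeff_mul] at h
  have hrev := Equiv.sum_comp Fin.revPerm
    (fun j : Fin n => completeSub y a j * (coFactor y k).coeff j)
  simp only [Fin.revPerm_apply] at hrev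
  rw [← h, hrev,
    Fin.sum_univ_eq_sum_range (fun r => completeSub y a r * (coFactor y k).coeff r),
    ← Finset.Nat.sum_antidiagonal_swap, Finset.Nat.sum_antidiagonal_eq_sum_range_succ_mk]
  have h1 : ∀ r ∈ range (a + 1), r ≤ a := fun r hr => by simpa [Nat.lt_succ_iff] using hr
  -- The two sums have different ranges, but the cofactor vanishes from `r = n` on and `completeSub`
  -- vanishes for `r > a`, so both extend to the longer range.
  have e1 : ∑ r ∈ range n, completeSub y a r * (coFactor y k).coeff r =
      ∑ r ∈ range (max n (a + 1)), completeSub y a r * (coFactor y k).coeff r := by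
    refine Finset.sum_subset (by simp) fun r _ hr => ?_
    rw [coeff_coFactor_eq_zero y k (by simpa using hr), mul_zero]
  have e2 : ∑ r ∈ range (a + 1), completeSub y a r * (coFactor y k).coeff r =
      ∑ r ∈ range (max n (a + 1)), completeSub y a r * (coFactor y k).coeff r := by
    refine Finset.sum_subset (by simp) fun r _ hr => ?_
    rw [completeSub, if_neg (by simpa using hr), zero_mul]
  rw [e1, ← e2]
  refine Finset.sum_congr rfl fun r hr => ?_
  have := h1 r hr
  simp only [Prod.swap, PowerSeries.coeff_mk, Polynomial.coeff_coe, completeSub, if_pos this]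

theorem det_pow_eq (a : Fin n → ℕ) :
    (Matrix.of fun i k => y k ^ a i).det =
      (Matrix.of fun i j : Fin n => completeSub y (a i) j.rev).det *
        (Matrix.of fun j k : Fin n => (coFactor y k).coeff j.rev).det := by
  rw [← Matrix.det_mul]
  congr 1
  ext i k
  rw [Matrix.mul_apply]
  exact (sum_completeSub_mul y (a i) k).symm

theorem prod_sub_eq_det :
    ∏ i, ∏ j ∈ Ioi i, (y i - y j) = (Matrix.of fun i k : Fin n => y k ^ (i.rev : ℕ)).det := by
  have h := Matrix.det_projVandermonde 1 y
  simp only [Pi.one_apply, one_mul] at h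
  rw [← h, ← Matrix.det_transpose]
  congr 1
  ext i k
  simp [Matrix.projVandermonde_apply]

/-- The Jacobi–Trudi identity. -/
theorem det_completeSub_mul_prod_sub (a : Fin n → ℕ) :
    (Matrix.of fun i j : Fin n => completeSub y (a i) j.rev).det * ∏ i, ∏ j ∈ Ioi i, (y i - y j) =
      (Matrix.of fun i k => y k ^ a i).det := by
  -- The factorization of `(y_k ^ a_i)` is also applied to the staircase exponents of the
  -- Vandermonde. Both have the same cofactor matrix, and for the staircase the matrix of complete
  -- polynomials is unitriangular.
  rw [prod_sub_eq_det, det_pow_eq y a, det_pow_eq y fun i => i.rev,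
    Matrix.det_of_isUpperTriangular (M := Matrix.of fun i j : Fin n => completeSub y i.rev j.rev)]
  · simp [completeSub, complete_zero]
  · intro i j hij
    have h : j < i := hij
    exact if_neg (not_le.2 (Fin.lt_def.1 (Fin.rev_lt_rev.2 h)))

end JacobiTrudi

/-! ### The Cauchy kernel and the norm of Frobenius' function -/

section Pairing

variable {m n : ℕ}

/-- A function `Fin n → ℕ` as an exponent. -/
abbrev expo (c : Fin n → ℕ) : Fin n →₀ ℕ := Finsupp.equivFunOnFinite.symm c

/-- The product of the power sums in `n` variables whose degrees are the cycle lengths of `g`. -/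
def cycleProd (n : ℕ) (g : Equiv.Perm (Fin m)) : MvPolynomial (Fin n) ℚ :=
  (g.partition.parts.map fun d => ∑ i, X i ^ d).prod

theorem prod_X_pow_eq (c : Fin n → ℕ) :
    ∏ i, (X i : MvPolynomial (Fin n) ℚ) ^ c i = monomial (expo c) 1 := by
  rw [MvPolynomial.monomial_eq, Finsupp.prod_fintype _ _ (by simp)]
  simp

theorem cycleProd_eq_sum (g : Equiv.Perm (Fin m)) :
    cycleProd n g = ∑ f : Fin m → Fin n with f ∘ g = f, monomial (expo (content f)) 1 := by
  rw [cycleProd, ← sum_fixed_prod]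
  exact Finset.sum_congr rfl fun f _ => by rw [prod_comp_word, prod_X_pow_eq]

theorem coeff_cycleProd (c : Fin n → ℕ) (g : Equiv.Perm (Fin m)) :
    coeff (expo c) (cycleProd n g) = permChar c g := by
  rw [cycleProd_eq_sum, coeff_sum, permChar, ← Finset.filter_filter]
  simp [coeff_monomial, Finset.sum_boole, Finset.filter_filter]

/-- A pair of words fixed by `g` is a fixed word in pairs of letters. Counting these by content
gives a sum over matrices with row sums `c`, which factors row by row into complete polynomials. -/
theorem sum_permChar_mul {R : Type*} [CommRing R] [Algebra ℚ R] (c : Fin n → ℕ)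
    (hc : ∑ i, c i = m) (y : Fin n → R) :
    ∑ g : Equiv.Perm (Fin m), permChar c g • (g.partition.parts.map fun d => ∑ i, y i ^ d).prod =
      (m.factorial : ℚ) • ∏ i, complete y (c i) := by
  let Φ : (Fin n × Fin n → ℕ) → R := fun C =>
    if (fun i => ∑ j, C (i, j)) = c then ∏ p, y p.2 ^ C p else 0
  have h1 : ∀ g : Equiv.Perm (Fin m),
      permChar c g • (g.partition.parts.map fun d => ∑ i, y i ^ d).prod =
        ∑ F : Fin m → Fin n × Fin n with F ∘ g = F, Φ (content F) := by
    intro g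
    have h2 : ∀ F : Fin m → Fin n × Fin n,
        (fun i => ∑ j, content F (i, j)) = content (Prod.fst ∘ F) := by
      intro F
      ext i
      rw [content, Finset.card_eq_sum_card_fiberwise (f := fun k => (F k).2) (t := univ) (by simp)]
      refine Finset.sum_congr rfl fun j _ => ?_
      rw [content, Finset.filter_filter]
      simp [Prod.ext_iff]
    have h3 : ∀ F : Fin m → Fin n × Fin n,
        F ∘ g = F ↔ (Prod.fst ∘ F) ∘ g = Prod.fst ∘ F ∧ (Prod.snd ∘ F) ∘ g = Prod.snd ∘ F := by
      intro F
      simp [funext_iff, Prod.ext_iff, forall_and]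
    rw [← sum_fixed_prod, permChar, ← Finset.sum_boole, Finset.sum_smul, Finset.sum_filter]
    simp_rw [Finset.smul_sum, Finset.sum_filter]
    rw [← Finset.sum_product', Finset.univ_product_univ]
    symm
    refine Fintype.sum_equiv (Equiv.arrowProdEquivProdArrow _ _ _) _ _ fun F => ?_
    simp only [Φ, h2, h3 F, ← prod_comp_word fun p : Fin n × Fin n => y p.2]
    change _ = (if (Prod.fst ∘ F) ∘ g = Prod.fst ∘ F ∧ content (Prod.fst ∘ F) = c then (1 : ℚ)
      else 0) • if (Prod.snd ∘ F) ∘ g = Prod.snd ∘ F then ∏ k, y ((Prod.snd ∘ F) k) else 0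
    split_ifs <;> simp_all
  simp_rw [h1]
  rw [sum_sum_fixed, ← Nat.cast_smul_eq_nsmul ℚ]
  congr 1
  simp only [Φ, complete]
  rw [← Finset.sum_filter, Finset.prod_univ_sum]
  refine Finset.sum_equiv (Equiv.curry _ _ _) (fun C => ?_) fun C _ => ?_
  · simp only [mem_filter, mem_piAntidiag, mem_univ, implies_true, and_true,
      Fintype.mem_piFinset, Equiv.curry_apply, Function.curry_apply]
    rw [funext_iff]
    refine ⟨fun h i => h.2 i, fun h => ⟨?_, h⟩⟩
    rw [Fintype.sum_prod_type, ← hc]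
    exact Finset.sum_congr rfl fun i _ => h i
  · rw [Fintype.prod_prod_type]
    rfl

/-- The coefficient of `y^a` in `Δ(y) ∏_d P_d(y)`, where `d` runs over the cycle lengths of `g`. -/
def frobChar (a : Fin n → ℕ) (g : Equiv.Perm (Fin m)) : ℚ :=
  coeff (expo a) ((∏ i, ∏ j ∈ Ioi i, (X i - X j)) * cycleProd n g)

theorem prod_sub_eq_sum :
    (∏ i, ∏ j ∈ Ioi i, (X i - X j) : MvPolynomial (Fin n) ℚ) =
      ∑ s : Equiv.Perm (Fin n),
        monomial (expo fun i => ((s i).rev : ℕ)) ((Equiv.Perm.sign s : ℤ) : ℚ) := by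
  rw [prod_sub_eq_det, Matrix.det_apply']
  refine Finset.sum_congr rfl fun s _ => ?_
  simp only [Matrix.of_apply]
  rw [prod_X_pow_eq, ← mul_one ((Equiv.Perm.sign s : ℤ) : ℚ), ← C_mul_monomial]
  simp

theorem frobChar_eq_sum (a : Fin n → ℕ) (g : Equiv.Perm (Fin m)) :
    frobChar a g = ∑ s : Equiv.Perm (Fin n), ((Equiv.Perm.sign s : ℤ) : ℚ) *
      if ∀ i, ((s i).rev : ℕ) ≤ a i then permChar (fun i => a i - (s i).rev) g else 0 := by
  rw [frobChar, prod_sub_eq_sum, Finset.sum_mul, coeff_sum]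
  refine Finset.sum_congr rfl fun s _ => ?_
  rw [coeff_monomial_mul']
  have : (expo fun i => ((s i).rev : ℕ)) ≤ expo a ↔ ∀ i, ((s i).rev : ℕ) ≤ a i := Iff.rfl
  simp only [this, mul_ite, mul_zero]
  congr 2
  rw [← coeff_cycleProd]
  congr 1
  ext i
  rfl

theorem frobChar_inv (a : Fin n → ℕ) (g : Equiv.Perm (Fin m)) : frobChar a g⁻¹ = frobChar a g := by
  simp only [frobChar_eq_sum, permChar_inv]

theorem sum_frobChar_smul (a : Fin n → ℕ) (ha : ∑ i, a i = m + ∑ i : Fin n, (i : ℕ)) :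
    ∑ g : Equiv.Perm (Fin m), frobChar a g • cycleProd n g =
      (m.factorial : ℚ) • (Matrix.of fun i j : Fin n => completeSub X (a i) j.rev).det := by
  have key : ∀ s : Equiv.Perm (Fin n), ∑ g : Equiv.Perm (Fin m),
      (if ∀ i, ((s i).rev : ℕ) ≤ a i then permChar (fun i => a i - (s i).rev) g else 0) •
        cycleProd n g = (m.factorial : ℚ) • ∏ i, completeSub X (a i) (s i).rev := by
    intro s
    split_ifs with h
    · have h1 : ∑ i, (a i - ((s i).rev : ℕ)) = m := by
        have h2 : ∑ i, ((s i).rev : ℕ) = ∑ i : Fin n, (i : ℕ) :=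
          Equiv.sum_comp (s.trans Fin.revPerm) (fun i : Fin n => (i : ℕ))
        rw [Finset.sum_tsub_distrib _ fun i _ => h i, ha, h2, Nat.add_sub_cancel]
      rw [show (∑ g : Equiv.Perm (Fin m), permChar (fun i => a i - ((s i).rev : ℕ)) g •
        cycleProd n g) = _ from sum_permChar_mul _ h1 X]
      congr 1
      exact Finset.prod_congr rfl fun i _ => by rw [completeSub, if_pos (h i)]
    · push Not at h
      obtain ⟨i, hi⟩ := h
      rw [Finset.prod_eq_zero (mem_univ i) (by rw [completeSub, if_neg (by omega)])]
      simp
  simp_rw [frobChar_eq_sum, Finset.sum_smul, mul_smul]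
  rw [Finset.sum_comm]
  simp_rw [← Finset.smul_sum, key]
  rw [← Matrix.det_transpose, Matrix.det_apply', Finset.smul_sum]
  refine Finset.sum_congr rfl fun s _ => ?_
  rw [smul_comm]
  simp [Algebra.smul_def]

/-- One factor is kept as a coefficient extraction while the other is summed against the power sums;
by Jacobi–Trudi this leaves the coefficient of `y^a` in `det (y_k ^ a_i)`. As the `a_i` are
distinct, only the identity permutation contributes. -/
theorem sum_frobChar_sq (a : Fin n → ℕ) (ha : ∑ i, a i = m + ∑ i : Fin n, (i : ℕ))
    (hinj : Function.Injective a) :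
    ∑ g : Equiv.Perm (Fin m), frobChar a g * frobChar a g = m.factorial := by
  have h : ∑ g : Equiv.Perm (Fin m), frobChar a g * frobChar a g =
      coeff (expo a) ((∏ i, ∏ j ∈ Ioi i, (X i - X j)) *
        ∑ g : Equiv.Perm (Fin m), frobChar a g • cycleProd n g) := by
    rw [Finset.mul_sum, coeff_sum]
    refine Finset.sum_congr rfl fun g _ => ?_
    rw [mul_smul_comm, coeff_smul, smul_eq_mul, ← frobChar]
  rw [h, sum_frobChar_smul a ha, mul_smul_comm, coeff_smul, mul_comm,
    det_completeSub_mul_prod_sub, ← Matrix.det_transpose, Matrix.det_apply', coeff_sum,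
    Finset.sum_eq_single 1]
  · simp only [Equiv.Perm.sign_one, Equiv.Perm.one_apply, Matrix.transpose_apply, Matrix.of_apply]
    rw [prod_X_pow_eq]
    simp
  · intro s _ hs
    have e : ∏ i, (X (s i) : MvPolynomial (Fin n) ℚ) ^ a i = ∏ i, X i ^ a (s⁻¹ i) := by
      rw [← Equiv.prod_comp s fun i => (X i : MvPolynomial (Fin n) ℚ) ^ a (s⁻¹ i)]
      simp
    simp only [Matrix.transpose_apply, Matrix.of_apply]
    rw [e, prod_X_pow_eq, ← map_intCast (C : ℚ →+* MvPolynomial (Fin n) ℚ), coeff_C_mul,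
      coeff_monomial, if_neg, mul_zero]
    intro h
    refine hs (inv_eq_one.1 (Equiv.ext fun i => hinj ?_))
    exact DFunLike.congr_fun h i
  · simp

end Pairing

/-! ### Column-injective words on a tableau -/

section Diagram

/-- Elements of `T` outside `range #T` are at least `#T`, and they replace equally many missing
elements below `#T`; each exchange costs at least one. -/
theorem sum_range_card_add_card_sdiff_le (T : Finset ℕ) :
    ∑ i ∈ range #T, i + #(T \ range #T) ≤ ∑ i ∈ T, i := by
  have h1 : (∑ i ∈ range #T \ T, (i : ℤ)) - ∑ i ∈ T \ range #T, (i : ℤ) =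
      (∑ i ∈ range #T, (i : ℤ)) - ∑ i ∈ T, (i : ℤ) := Finset.sum_sdiff_sub_sum_sdiff
  have h2 : #(T \ range #T) = #(range #T \ T) := Finset.card_sdiff_comm (by simp)
  have h3 : #(T \ range #T) * #T ≤ ∑ i ∈ T \ range #T, i := by
    rw [← smul_eq_mul]
    exact Finset.card_nsmul_le_sum _ _ _ fun i hi => by simpa using (mem_sdiff.1 hi).2
  have h4 : ∑ i ∈ range #T \ T, (i + 1) ≤ #(range #T \ T) * #T := by
    rw [← smul_eq_mul]
    exact Finset.sum_le_card_nsmul _ _ _ fun i hi => by simpa using (mem_sdiff.1 hi).1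
  rw [Finset.sum_add_distrib, ← h2] at h4
  simp only [sum_const, smul_eq_mul, mul_one] at h4
  zify at h3 h4 ⊢
  linarith

variable {m : ℕ} (lam : m.Partition)

theorem rows_sorted : (rows lam).Pairwise (· ≥ ·) := Multiset.pairwise_sort _ _

theorem rows_pos {x : ℕ} (hx : x ∈ rows lam) : 0 < x :=
  lam.parts_pos (by simpa [rows] using hx)

/-- The row of an entry, as an index of the list of rows. -/
def rowFin (k : Fin m) : Fin (rows lam).length := (tableau lam k).1

theorem col_lt (k : Fin m) : col lam k < (rows lam)[rowFin lam k] := (tableau lam k).2.2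

theorem col_lt_size (k : Fin m) : col lam k < m := by
  have h : ∑ i : Fin (rows lam).length, (rows lam)[i] = m := sum_rows lam
  have := Finset.single_le_sum (f := fun i : Fin (rows lam).length => (rows lam)[i])
    (fun _ _ => Nat.zero_le _) (mem_univ (rowFin lam k))
  exact (col_lt lam k).trans_le (this.trans h.le)

theorem exists_box (i : Fin (rows lam).length) {j : ℕ} (hj : j < (rows lam)[i]) :
    ∃ k, rowFin lam k = i ∧ col lam k = j :=
  ⟨(tableau lam).symm ⟨i, j, hj⟩, by rw [rowFin, Equiv.apply_symm_apply],
    congrArg (fun p : (i : Fin (rows lam).length) × Fin ((rows lam)[i]) => (p.2 : ℕ))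
      ((tableau lam).apply_symm_apply ⟨i, j, hj⟩)⟩

theorem eq_of_row_col {k l : Fin m} (h1 : row lam k = row lam l) (h2 : col lam k = col lam l) :
    k = l := by
  refine (tableau lam).injective ?_
  have h1' : (tableau lam k).1 = (tableau lam l).1 := Fin.ext h1
  have h2' : ((tableau lam k).2 : ℕ) = (tableau lam l).2 := h2
  revert h1' h2'
  generalize tableau lam k = p
  generalize tableau lam l = q
  obtain ⟨i, j⟩ := p
  obtain ⟨i', j'⟩ := q
  rintro h h2
  cases h
  congr 1
  exact Fin.ext h2

theorem rows_antitone {i j : Fin (rows lam).length} (h : i ≤ j) :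
    (rows lam)[j] ≤ (rows lam)[i] := by
  rcases h.eq_or_lt with rfl | h
  · exact le_rfl
  · exact List.pairwise_iff_getElem.1 (rows_sorted lam) i j i.2 j.2 h

theorem exists_above {i : ℕ} (k : Fin m) (hi : i ≤ row lam k) :
    ∃ l, row lam l = i ∧ col lam l = col lam k := by
  obtain ⟨l, h1, h2⟩ := exists_box lam ⟨i, hi.trans_lt (rowFin lam k).2⟩
    ((col_lt lam k).trans_le (rows_antitone lam (show _ ≤ rowFin lam k from hi)))
  exact ⟨l, congrArg Fin.val h1, h2⟩

/-- A word is column-injective if no letter occurs twice in a column of the tableau. -/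
def ColInj {ι : Type*} (f : Fin m → ι) : Prop := ∀ k l, col lam k = col lam l → f k = f l → k = l

theorem image_row_col (j : ℕ) :
    ({k | col lam k = j} : Finset (Fin m)).image (row lam) = range #{k | col lam k = j} := by
  have hinj : Set.InjOn (row lam) ({k | col lam k = j} : Finset (Fin m)) := by
    intro k hk l hl h
    simp only [coe_filter, mem_univ, true_and, Set.mem_ofPred_eq] at hk hl
    exact eq_of_row_col lam h (hk.trans hl.symm)
  refine Finset.eq_of_subset_of_card_le ?_ (by rw [card_range, card_image_of_injOn hinj])
  intro i hi
  rw [mem_image] at hi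
  obtain ⟨k, hk, rfl⟩ := hi
  rw [mem_range, ← Nat.succ_le_iff, ← card_range (row lam k).succ, ← card_image_of_injOn hinj]
  refine card_le_card fun i hi => ?_
  obtain ⟨l, h1, h2⟩ := exists_above lam k (Nat.lt_succ_iff.1 (mem_range.1 hi))
  exact mem_image.2 ⟨l, by simpa [h2] using hk, h1⟩

/-- The letters of a column of height `h` are distinct, so their sum is at least `0 + 1 + ⋯ + (h -
1)`, the sum of the row indices, plus the number of letters that are `h` or more. This excess term
controls the case of equality. -/
theorem ColInj.sum_row_add_le {f : Fin m → ℕ} (hf : ColInj lam f) :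
    ∑ k, row lam k + ∑ j ∈ range m, #(({k | col lam k = j} : Finset (Fin m)).image f \
      range #{k | col lam k = j}) ≤ ∑ k, f k := by
  have hcol : ∀ k ∈ (univ : Finset (Fin m)), col lam k ∈ range m := fun k _ =>
    mem_range.2 (col_lt_size lam k)
  rw [← Finset.sum_fiberwise_of_maps_to hcol, ← Finset.sum_fiberwise_of_maps_to hcol f,
    ← Finset.sum_add_distrib]
  refine Finset.sum_le_sum fun j _ => ?_
  have h1 : Set.InjOn (row lam) ({k | col lam k = j} : Finset (Fin m)) := by
    intro k hk l hl h
    simp only [coe_filter, mem_univ, true_and, Set.mem_ofPred_eq] at hk hl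
    exact eq_of_row_col lam h (hk.trans hl.symm)
  have h2 : Set.InjOn f ({k | col lam k = j} : Finset (Fin m)) := by
    intro k hk l hl h
    simp only [coe_filter, mem_univ, true_and, Set.mem_ofPred_eq] at hk hl
    exact hf k l (hk.trans hl.symm) h
  have h3 := sum_range_card_add_card_sdiff_le (({k | col lam k = j} : Finset (Fin m)).image f)
  rw [card_image_of_injOn h2, Finset.sum_image h2] at h3
  rwa [← Finset.sum_image (f := fun i => i) h1, image_row_col]

theorem ColInj.sum_row_le {f : Fin m → ℕ} (hf : ColInj lam f) : ∑ k, row lam k ≤ ∑ k, f k :=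
  le_trans (Nat.le_add_right _ _) (hf.sum_row_add_le lam)

/-- With equality no letter exceeds the height of its column, so each entry can be moved within its
column to the row named by its letter. -/
theorem ColInj.exists_perm {f : Fin m → ℕ} (hf : ColInj lam f) (h : ∑ k, f k = ∑ k, row lam k) :
    ∃ q : Equiv.Perm (Fin m), (∀ k, col lam (q k) = col lam k) ∧ ∀ k, row lam (q k) = f k := by
  have h0 := hf.sum_row_add_le lam
  have h1 : ∀ k, ∃ l, col lam l = col lam k ∧ row lam l = f k := by
    intro k
    have hk : col lam k ∈ range m := mem_range.2 (col_lt_size lam k)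
    have h2 : ∑ j ∈ range m, #(({k | col lam k = j} : Finset (Fin m)).image f \
      range #{k | col lam k = j}) = 0 := by omega
    have h3 := (Finset.sum_eq_zero_iff.1 h2) _ hk
    rw [card_eq_zero, sdiff_eq_empty_iff_subset, ← image_row_col] at h3
    obtain ⟨l, hl, h4⟩ := mem_image.1 (h3 (mem_image_of_mem f (by simp : k ∈ _)))
    exact ⟨l, by simpa using hl, h4⟩
  choose q hq1 hq2 using h1
  have hq : Function.Injective q := fun k l e =>
    hf k l (by rw [← hq1, e, hq1]) (by rw [← hq2, e, hq2])
  exact ⟨Equiv.ofBijective q (Finite.injective_iff_bijective.1 hq), hq1, hq2⟩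

theorem sum_word_eq {n : ℕ} (f : Fin m → Fin n) :
    ∑ k, (f k : ℕ) = ∑ i, content f i * i := by
  rw [← Finset.sum_fiberwise univ f]
  refine Finset.sum_congr rfl fun i _ => ?_
  rw [content, ← smul_eq_mul, ← Finset.sum_const]
  exact Finset.sum_congr rfl fun k hk => by rw [(mem_filter.1 hk).2]

theorem content_rowFin (i : Fin (rows lam).length) : content (rowFin lam) i = (rows lam)[i] := by
  have : #{p : (i : Fin (rows lam).length) × Fin ((rows lam)[i]) | p.1 = i} = (rows lam)[i] := by
    rw [← Fintype.card_subtype, Fintype.card_congr (Equiv.sigmaSubtype i)]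
    simp
  rw [← this]
  exact Finset.card_equiv (tableau lam) fun k => by rw [mem_filter, mem_filter]; simp [rowFin]

/-- Each letter of a column-injective word occurs at most as often as there are columns. -/
theorem ColInj.content_le {ι : Type*} [DecidableEq ι] {f : Fin m → ι} (hf : ColInj lam f) (i : ι) :
    content f i ≤ (rows lam).headD 0 := by
  rw [content, ← card_range ((rows lam).headD 0)]
  refine Finset.card_le_card_of_injOn (col lam) (fun k _ => ?_) fun k hk l hl h => ?_
  · have h0 : 0 < (rows lam).length := (Nat.zero_le _).trans_lt (rowFin lam k).2
    have h1 := (col_lt lam k).trans_le (rows_antitone lam (show ⟨0, h0⟩ ≤ rowFin lam k from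
      Nat.zero_le _))
    rw [mem_coe, mem_range, List.headD_eq_head?_getD, List.head?_eq_getElem?,
      List.getElem?_eq_getElem h0]
    exact h1
  · simp only [coe_filter, mem_univ, true_and, Set.mem_ofPred_eq] at hk hl
    exact hf k l h (hk.trans hl.symm)

end Diagram

/-- Additive inverses need not be given: multiplication by `-1 : ℚ` supplies them. -/
theorem finrank_eq_one_of {M : Type*} [AddCommMonoid M] [Module ℚ M] (v : M)
    (hv : v ≠ 0) (h : ∀ w : M, ∃ r : ℚ, r • v = w) :
    Module.finrank ℚ M = 1 := by
  have hb : Function.Bijective (LinearMap.toSpanSingleton ℚ M v) := by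
    refine ⟨fun r s e => ?_, h⟩
    by_contra hne
    have e' : r • v = s • v := e
    refine hv ?_
    have h1 : (r - s) • v + s • v = 0 + s • v := by rw [← add_smul, sub_add_cancel, e', zero_add]
    let := Module.addCommMonoidToAddCommGroup ℚ (M := M)
    have h2 : (r - s) • v = 0 := add_right_cancel h1
    rw [← one_smul ℚ v, ← inv_mul_cancel₀ (sub_ne_zero.2 hne), mul_smul, h2, smul_zero]
  rw [← (LinearEquiv.ofBijective _ hb).finrank_eq, Module.finrank_self]

/-! ### Young symmetrizers and the simple modules -/

section Young

variable {m : ℕ} {ι : Type*} [DecidableEq ι]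

/-- The permutations that fix a word. -/
abbrev stabFinset (f : Fin m → ι) : Finset (Equiv.Perm (Fin m)) := {g | f ∘ g = f}

/-- The sum of the permutations that fix a word. -/
def stabSum (f : Fin m → ι) : MonoidAlgebra ℚ (Equiv.Perm (Fin m)) :=
  ∑ g ∈ stabFinset f, MonoidAlgebra.single g 1

theorem stabSum_mul_single {f : Fin m → ι} {h : Equiv.Perm (Fin m)} (hh : f ∘ h = f) :
    stabSum f * MonoidAlgebra.single h 1 = stabSum f := by
  rw [stabSum, Finset.sum_mul]
  refine Finset.sum_equiv (Equiv.mulRight h) (fun g => ?_) fun g _ => ?_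
  · simp only [mem_filter, mem_univ, true_and, Equiv.coe_mulRight, Equiv.Perm.coe_mul,
      ← Function.comp_assoc]
    refine ⟨fun e => by rw [e, hh], fun e => ?_⟩
    have := congrArg (· ∘ ⇑h⁻¹) (e.trans hh.symm)
    simpa [Function.comp_assoc] using this
  · simp [MonoidAlgebra.single_mul_single]

theorem stabSum_mul_of_fixed {f : Fin m → ι} {v : MonoidAlgebra ℚ (Equiv.Perm (Fin m))}
    (hv : ∀ g : Equiv.Perm (Fin m), f ∘ g = f → MonoidAlgebra.single g 1 * v = v) :
    stabSum f * v = (#(stabFinset f) : ℚ) • v := by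
  rw [stabSum, Finset.sum_mul, Finset.sum_congr rfl fun g hg => hv g (mem_filter.1 hg).2,
    Finset.sum_const, Nat.cast_smul_eq_nsmul]

theorem card_stab_ne_zero (f : Fin m → ι) : (#(stabFinset f) : ℚ) ≠ 0 := by
  rw [Nat.cast_ne_zero, card_ne_zero]
  exact ⟨1, by simp⟩

variable (lam : m.Partition)

/-- The signed sum of the permutations preserving each column. -/
def colSum : MonoidAlgebra ℚ (Equiv.Perm (Fin m)) :=
  ∑ g : Equiv.Perm (Fin m) with ∀ k, col lam (g k) = col lam k,
    MonoidAlgebra.single g (((Equiv.Perm.sign g : ℤ) : ℚ))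

theorem single_mul_colSum {q : Equiv.Perm (Fin m)} (hq : ∀ k, col lam (q k) = col lam k) :
    MonoidAlgebra.single q 1 * colSum lam = ((Equiv.Perm.sign q : ℤ) : ℚ) • colSum lam := by
  rw [colSum, Finset.mul_sum, Finset.smul_sum]
  refine Finset.sum_equiv (Equiv.mulLeft q) (fun g => ?_) fun g _ => ?_
  · simp [hq]
  · simp only [MonoidAlgebra.single_mul_single, one_mul, Equiv.coe_mulLeft,
      MonoidAlgebra.smul_single, smul_eq_mul, Equiv.Perm.sign_mul, Units.val_mul, Int.cast_mul]
    rw [← mul_assoc, ← Int.cast_mul, ← Units.val_mul]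
    simp

theorem row_fixed_iff (g : Equiv.Perm (Fin m)) :
    (∀ k, row lam (g k) = row lam k) ↔ rowFin lam ∘ g = rowFin lam := by
  rw [funext_iff]
  exact forall_congr' fun k => (Fin.ext_iff (a := rowFin lam (g k)) (b := rowFin lam k)).symm

theorem youngSymmetrizer_eq : youngSymmetrizer lam = stabSum (rowFin lam) * colSum lam := by
  simp only [youngSymmetrizer, stabSum, colSum, row_fixed_iff]

theorem single_mul_youngSymmetrizer {g : Equiv.Perm (Fin m)} (hg : rowFin lam ∘ g = rowFin lam) :
    MonoidAlgebra.single g 1 * youngSymmetrizer lam = youngSymmetrizer lam := by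
  rw [youngSymmetrizer_eq, ← mul_assoc]
  congr 1
  rw [stabSum, Finset.mul_sum]
  refine Finset.sum_equiv (Equiv.mulLeft g) (fun h => ?_) fun h _ => ?_
  · simp only [mem_filter, mem_univ, true_and, Equiv.coe_mulLeft, Equiv.Perm.coe_mul,
      ← Function.comp_assoc, hg]
  · simp [MonoidAlgebra.single_mul_single]

/-- A permutation preserving both rows and columns is the identity, so the coefficient at `1`
receives a single contribution. -/
theorem youngSymmetrizer_ne_zero : youngSymmetrizer lam ≠ 0 := by
  intro h
  have h1 : (youngSymmetrizer lam).coeff 1 = 1 := by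
    rw [youngSymmetrizer, Finset.sum_mul_sum]
    simp only [MonoidAlgebra.single_mul_single, one_mul, MonoidAlgebra.coeff_sum,
      Finsupp.finsetSum_apply, MonoidAlgebra.coeff_single, Finsupp.single_apply]
    rw [Finset.sum_eq_single 1, Finset.sum_eq_single 1]
    · simp
    · intro q _ hq
      rw [one_mul, if_neg hq]
    · simp
    · intro p hp hp1
      refine Finset.sum_eq_zero fun q hq => if_neg fun e => hp1 (Equiv.ext fun k => ?_)
      rw [mem_filter] at hp hq
      have e' : q = p⁻¹ := eq_inv_of_mul_eq_one_right e
      refine eq_of_row_col lam (hp.2 k) ?_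
      have := hq.2 (p k)
      rw [e', Equiv.Perm.inv_def, Equiv.symm_apply_apply] at this
      exact this.symm
    · simp
  rw [h] at h1
  simp at h1

/-- If `k` and `l` share a column and a letter of `f ∘ g`, the transposition of `k` and `l` is
absorbed by `colSum` with sign `-1`, while its conjugate by `g` is absorbed by `stabSum f` with sign
`+1`. The product equals its opposite. -/
theorem stabSum_mul_single_mul_colSum_eq_zero {f : Fin m → ι} {g : Equiv.Perm (Fin m)}
    (h : ¬ ColInj lam (f ∘ g)) : stabSum f * MonoidAlgebra.single g 1 * colSum lam = 0 := by
  simp only [ColInj, not_forall] at h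
  obtain ⟨k, l, hc, hf, hne⟩ := h
  have h1 : ∀ x, col lam (Equiv.swap k l x) = col lam x := by
    intro x
    by_cases hk : x = k
    · rw [hk, Equiv.swap_apply_left, hc]
    · by_cases hl : x = l
      · rw [hl, Equiv.swap_apply_right, hc]
      · rw [Equiv.swap_apply_of_ne_of_ne hk hl]
  have h2 : f ∘ Equiv.swap (g k) (g l) = f := by
    ext x
    by_cases hk : x = g k
    · rw [hk, Function.comp_apply, Equiv.swap_apply_left]; exact hf.symm
    · by_cases hl : x = g l
      · rw [hl, Function.comp_apply, Equiv.swap_apply_right]; exact hf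
      · rw [Function.comp_apply, Equiv.swap_apply_of_ne_of_ne hk hl]
  have h3 : stabSum f * MonoidAlgebra.single g 1 * (MonoidAlgebra.single (Equiv.swap k l) 1 *
      colSum lam) = stabSum f * MonoidAlgebra.single g 1 * colSum lam := by
    nth_rw 2 [← stabSum_mul_single h2]
    rw [← mul_assoc, mul_assoc (stabSum f), mul_assoc (stabSum f) (MonoidAlgebra.single _ _),
      MonoidAlgebra.single_mul_single, MonoidAlgebra.single_mul_single,
      Equiv.swap_apply_apply, inv_mul_cancel_right]
  rw [single_mul_colSum lam h1, Equiv.Perm.sign_swap hne, mul_smul_comm] at h3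
  simp only [Units.val_neg, Units.val_one, Int.cast_neg, Int.cast_one, neg_smul, one_smul] at h3
  have h4 : (2 : ℚ) • (stabSum f * MonoidAlgebra.single g 1 * colSum lam) = 0 := by
    rw [two_smul]
    nth_rw 1 [← h3]
    exact neg_add_cancel _
  exact (smul_eq_zero.1 h4).resolve_left two_ne_zero

/-- Von Neumann's lemma. The word `row ∘ g` has the least letter sum possible, so if it is
column-injective then `g = p q` with `p` preserving rows and `q` preserving columns; otherwise the
product vanishes. -/
theorem stabSum_mul_single_mul_colSum_mem (g : Equiv.Perm (Fin m)) :
    stabSum (rowFin lam) * MonoidAlgebra.single g 1 * colSum lam ∈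
      Submodule.span ℚ {youngSymmetrizer lam} := by
  by_cases h : ColInj lam (rowFin lam ∘ g)
  · have h' : ColInj lam (row lam ∘ g) := fun k l hc e => h k l hc (Fin.ext e)
    obtain ⟨q, hq1, hq2⟩ := h'.exists_perm lam (Equiv.sum_comp g (row lam))
    have e : g = (g * q⁻¹) * q := by simp
    have hp : rowFin lam ∘ (g * q⁻¹ : Equiv.Perm (Fin m)) = rowFin lam := by
      ext k
      have := hq2 (q⁻¹ k)
      rw [Equiv.Perm.inv_def, Equiv.apply_symm_apply] at this
      exact this.symm
    have e2 : (MonoidAlgebra.single g 1 : MonoidAlgebra ℚ (Equiv.Perm (Fin m))) =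
        MonoidAlgebra.single (g * q⁻¹) 1 * MonoidAlgebra.single q 1 := by
      rw [MonoidAlgebra.single_mul_single, ← e, one_mul]
    rw [e2, ← mul_assoc, stabSum_mul_single hp, mul_assoc, single_mul_colSum lam hq1,
      mul_smul_comm, ← youngSymmetrizer_eq]
    exact Submodule.smul_mem _ _ (Submodule.mem_span_singleton_self _)
  · rw [stabSum_mul_single_mul_colSum_eq_zero lam h]
    exact zero_mem _

theorem stabSum_mul_mul_colSum_mem {f : Fin m → ι}
    {U : Submodule ℚ (MonoidAlgebra ℚ (Equiv.Perm (Fin m)))}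
    (hU : ∀ g, stabSum f * MonoidAlgebra.single g 1 * colSum lam ∈ U)
    (x : MonoidAlgebra ℚ (Equiv.Perm (Fin m))) : stabSum f * x * colSum lam ∈ U := by
  induction x using MonoidAlgebra.induction_linear with
  | zero => simp
  | add x y hx hy => rw [mul_add, add_mul]; exact U.add_mem hx hy
  | single g r =>
    have : (MonoidAlgebra.single g r : MonoidAlgebra ℚ (Equiv.Perm (Fin m))) =
      r • MonoidAlgebra.single g 1 := by simp
    rw [this, mul_smul_comm, smul_mul_assoc]
    exact U.smul_mem _ (hU g)

theorem exists_eq_mul_colSum (v : simpleModule lam) :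
    ∃ x, (v : MonoidAlgebra ℚ (Equiv.Perm (Fin m))) = x * colSum lam := by
  obtain ⟨x, hx⟩ := Submodule.mem_span_singleton.1 v.2
  exact ⟨x * stabSum (rowFin lam), by rw [← hx, youngSymmetrizer_eq, smul_eq_mul, mul_assoc]⟩

/-- A vector fixed by the stabilizer of `f` is, up to the nonzero order of that stabilizer, its own
product with `stabSum f`, and every vector of the module is a left multiple of `colSum`. -/
theorem mem_of_fixed {f : Fin m → ι}
    {U : Submodule ℚ (MonoidAlgebra ℚ (Equiv.Perm (Fin m)))}
    (hU : ∀ g, stabSum f * MonoidAlgebra.single g 1 * colSum lam ∈ U) (v : simpleModule lam)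
    (hv : ∀ g : Equiv.Perm (Fin m), f ∘ g = f → MonoidAlgebra.single g 1 * v.1 = v.1) :
    v.1 ∈ U := by
  obtain ⟨x, hx⟩ := exists_eq_mul_colSum lam v
  have h := stabSum_mul_mul_colSum_mem lam hU x
  rw [mul_assoc, ← hx, stabSum_mul_of_fixed hv] at h
  exact (U.smul_mem_iff (card_stab_ne_zero f)).1 h

theorem simpleRep_apply (g : Equiv.Perm (Fin m)) (v : simpleModule lam) :
    simpleRep lam g v = MonoidAlgebra.single g (1 : ℚ) • v := by
  simp [simpleRep, Representation.ofModule']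

theorem coe_simpleRep (g : Equiv.Perm (Fin m)) (v : simpleModule lam) :
    (simpleRep lam g v).1 = MonoidAlgebra.single g (1 : ℚ) * v.1 := by
  rw [simpleRep_apply]
  rfl

/-- The generator of the simple module. -/
def generator : simpleModule lam := ⟨youngSymmetrizer lam, Submodule.mem_span_singleton_self _⟩

theorem generator_ne_zero : generator lam ≠ 0 := fun h =>
  youngSymmetrizer_ne_zero lam (congrArg Subtype.val h)

theorem exists_eq_smul_generator (v : simpleModule lam)
    (hv : ∀ g : Equiv.Perm (Fin m), rowFin lam ∘ g = rowFin lam → simpleRep lam g v = v) :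
    ∃ r : ℚ, r • generator lam = v := by
  have := mem_of_fixed lam (stabSum_mul_single_mul_colSum_mem lam) v fun g hg => by
    rw [← coe_simpleRep, hv g hg]
  obtain ⟨r, hr⟩ := Submodule.mem_span_singleton.1 this
  exact ⟨r, Subtype.ext hr⟩

theorem simpleRep_generator {g : Equiv.Perm (Fin m)} (hg : rowFin lam ∘ g = rowFin lam) :
    simpleRep lam g (generator lam) = generator lam :=
  Subtype.ext (by rw [coe_simpleRep]; exact single_mul_youngSymmetrizer lam hg)

/-- The stabilizer of a word. -/
def wordStab (f : Fin m → ι) : Subgroup (Equiv.Perm (Fin m)) where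
  carrier := {g | f ∘ g = f}
  one_mem' := by simp
  mul_mem' {g h} hg hh := by
    simp only [Set.mem_ofPred_eq, Equiv.Perm.coe_mul, ← Function.comp_assoc] at *
    rw [hg, hh]
  inv_mem' {g} hg := (comp_inv_eq_iff f g).2 hg

instance (f : Fin m → ι) : DecidablePred (· ∈ wordStab f) := fun g =>
  inferInstanceAs (Decidable (f ∘ g = f))

theorem sum_char_stab (f : Fin m → ι) :
    ∑ g ∈ stabFinset f, simpleChar lam g =
      #(stabFinset f) *
        (Module.finrank ℚ
          (Representation.invariants ((simpleRep lam).comp (wordStab f).subtype)) : ℚ) := by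
  have hne : (Nat.card (wordStab f) : ℚ) ≠ 0 := by simp
  let := invertibleOfNonzero hne
  have h := Representation.card_inv_mul_sum_char_eq_finrank
    ((simpleRep lam).comp (wordStab f).subtype)
  have hcard : Nat.card (wordStab f) = #(stabFinset f) := by
    rw [Nat.card_eq_fintype_card]
    exact Fintype.card_subtype _
  rw [← h, ← hcard, mul_inv_cancel_left₀ hne]
  exact Finset.sum_subtype _ (fun g => by simp [wordStab]) _

theorem sum_char_stab_eq_zero {f : Fin m → ι}
    (hf : ∀ g : Equiv.Perm (Fin m), ¬ ColInj lam (f ∘ g)) :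
    ∑ g ∈ stabFinset f, simpleChar lam g = 0 := by
  rw [sum_char_stab, mul_eq_zero]
  right
  rw [Nat.cast_eq_zero, Submodule.finrank_eq_zero, eq_bot_iff]
  intro v hv
  have := mem_of_fixed lam (U := ⊥) (f := f) (fun g => by
    rw [stabSum_mul_single_mul_colSum_eq_zero lam (hf g)]; exact zero_mem _) v fun g hg => by
      rw [← coe_simpleRep]
      exact congrArg Subtype.val (hv ⟨g, hg⟩)
  exact Subtype.ext this

theorem sum_char_stab_rowFin :
    ∑ g ∈ stabFinset (rowFin lam), simpleChar lam g =
      #(stabFinset (rowFin lam)) := by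
  rw [sum_char_stab]
  suffices h : Module.finrank ℚ
      (Representation.invariants ((simpleRep lam).comp (wordStab (rowFin lam)).subtype)) = 1 by
    simp [h]
  refine finrank_eq_one_of ⟨generator lam, fun g => simpleRep_generator lam g.2⟩ ?_ ?_
  · intro h
    exact generator_ne_zero lam (congrArg Subtype.val h)
  · intro w
    obtain ⟨r, hr⟩ := exists_eq_smul_generator lam w.1 fun g hg => w.2 ⟨g, hg⟩
    exact ⟨r, Subtype.ext hr⟩

/-- An equivariant endomorphism sends the generator to a vector fixed by the row stabilizer, hence
to a rational multiple of the generator. As the module is cyclic, this determines the map. -/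
theorem finrank_intertwiningMap :
    Module.finrank ℚ ((simpleRep lam).IntertwiningMap (simpleRep lam)) = 1 := by
  refine finrank_eq_one_of (Representation.IntertwiningMap.id (simpleRep lam)) ?_ fun T => ?_
  · intro h
    exact generator_ne_zero lam (congrArg (fun T => T (generator lam)) h)
  · obtain ⟨r, hr⟩ := exists_eq_smul_generator lam (T (generator lam)) fun g hg => by
      rw [← T.isIntertwining, simpleRep_generator lam hg]
    refine ⟨r, Representation.IntertwiningMap.ext (LinearMap.ext fun v => ?_)⟩
    have key : ∀ x : MonoidAlgebra ℚ (Equiv.Perm (Fin m)), ∀ v : simpleModule lam,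
        T (x • v) = x • T v := by
      intro x v
      induction x using MonoidAlgebra.induction_linear with
      | zero => simp
      | add x y hx hy => rw [add_smul, add_smul, map_add, hx, hy]
      | single g s =>
        have : (MonoidAlgebra.single g s : MonoidAlgebra ℚ (Equiv.Perm (Fin m))) =
          s • MonoidAlgebra.single g 1 := by simp
        rw [this, smul_assoc, smul_assoc, map_smul, ← simpleRep_apply, ← simpleRep_apply,
          T.isIntertwining]
    obtain ⟨x, hx⟩ := Submodule.mem_span_singleton.1 v.2
    have hv : v = x • generator lam := Subtype.ext hx.symm
    change r • v = T v
    rw [hv, key, ← hr, smul_comm]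

end Young

/-! ### Pairing simple characters with permutation characters -/

section Characters

variable {m : ℕ}

theorem scalarProd_eq_finrank {V W : Type*} [AddCommGroup V] [Module ℚ V] [FiniteDimensional ℚ V]
    [AddCommGroup W] [Module ℚ W] [FiniteDimensional ℚ W]
    (r : Representation ℚ (Equiv.Perm (Fin m)) V) (s : Representation ℚ (Equiv.Perm (Fin m)) W) :
    scalarProd r.character s.character = Module.finrank ℚ (s.IntertwiningMap r) := by
  have hne : (Nat.card (Equiv.Perm (Fin m)) : ℚ) ≠ 0 := by simp
  let := invertibleOfNonzero hne
  rw [← Representation.card_inv_mul_sum_char_mul_char_eq_finrank, scalarProd,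
    Nat.card_eq_fintype_card]

theorem scalarProd_simpleChar_self (lam : m.Partition) :
    scalarProd (simpleChar lam) (simpleChar lam) = 1 := by
  rw [simpleChar, scalarProd_eq_finrank, finrank_intertwiningMap, Nat.cast_one]

theorem simpleChar_conj (lam : m.Partition) (g h : Equiv.Perm (Fin m)) :
    simpleChar lam (h * g * h⁻¹) = simpleChar lam g :=
  Representation.char_conj _ g h

theorem isConj_inv (g : Equiv.Perm (Fin m)) : IsConj g g⁻¹ :=
  Equiv.Perm.isConj_iff_cycleType_eq.2 (by simp)

theorem simpleChar_inv (lam : m.Partition) (g : Equiv.Perm (Fin m)) :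
    simpleChar lam g⁻¹ = simpleChar lam g := by
  obtain ⟨c, hc⟩ := isConj_iff.1 (isConj_inv g)
  rw [← hc, simpleChar_conj]

theorem sum_simpleChar_mul_permChar {ι : Type*} [Fintype ι] [DecidableEq ι] (lam : m.Partition)
    (c : ι → ℕ) : ∑ g, simpleChar lam g * permChar c g =
      ∑ f : Fin m → ι with content f = c,
        ∑ g ∈ stabFinset f, simpleChar lam g := by
  simp_rw [permChar, ← Finset.sum_boole, Finset.mul_sum, Finset.sum_filter]
  rw [Finset.sum_comm]
  refine Finset.sum_congr rfl fun f _ => ?_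
  split_ifs with h <;> simp [h]

theorem scalarProd_permChar_eq_zero {ι : Type*} [Fintype ι] [DecidableEq ι] (lam : m.Partition)
    (c : ι → ℕ) (hc : ∀ f : Fin m → ι, content f = c → ¬ ColInj lam f) :
    scalarProd (simpleChar lam) (permChar c) = 0 := by
  simp only [scalarProd, permChar_inv]
  rw [sum_simpleChar_mul_permChar, Finset.sum_eq_zero, mul_zero]
  intro f hf
  refine sum_char_stab_eq_zero lam fun g => hc _ ?_
  rw [content_comp, (mem_filter.1 hf).2]

/-- All words with this content are rearrangements of `rowFin lam`, so their stabilizers are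
conjugate and each has a one-dimensional space of invariants in `V_λ`. Orbit-stabilizer then gives
the total `m!`. -/
theorem scalarProd_permChar_self (lam : m.Partition) :
    scalarProd (simpleChar lam) (permChar (content (rowFin lam))) = 1 := by
  have h : ∀ f : Fin m → Fin (rows lam).length, content f = content (rowFin lam) →
      ∑ g ∈ stabFinset f, simpleChar lam g =
        #(stabFinset f) := by
    intro f hf
    obtain ⟨s, rfl⟩ := exists_comp_perm_of_content_eq hf.symm
    have hs : ∀ g : Equiv.Perm (Fin m), (rowFin lam ∘ s) ∘ g = rowFin lam ∘ s ↔
        rowFin lam ∘ (s * g * s⁻¹ : Equiv.Perm (Fin m)) = rowFin lam := by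
      intro g
      rw [← (s⁻¹.surjective.injective_comp_right).eq_iff]
      simp [Function.comp_assoc, Equiv.Perm.coe_mul]
    have e1 : ∑ g ∈ stabFinset (rowFin lam ∘ s),
        simpleChar lam g = ∑ g ∈ stabFinset (rowFin lam),
        simpleChar lam g :=
      Finset.sum_equiv (MulAut.conj s).toEquiv
        (fun g => by simp only [mem_filter, mem_univ, true_and, hs]; rfl) fun g _ =>
        (simpleChar_conj lam g s).symm
    have e2 : #(stabFinset (rowFin lam ∘ s)) =
        #(stabFinset (rowFin lam)) :=
      Finset.card_equiv (MulAut.conj s).toEquiv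
        (fun g => by simp only [mem_filter, mem_univ, true_and, hs]; rfl)
    rw [e1, e2, sum_char_stab_rowFin]
  simp only [scalarProd, permChar_inv]
  rw [sum_simpleChar_mul_permChar, Finset.sum_congr rfl fun f hf => h f (mem_filter.1 hf).2,
    ← Nat.cast_sum, sum_card_stabilizer _ (sum_content _)]
  rw [Fintype.card_perm, Fintype.card_fin, inv_mul_cancel₀]
  exact_mod_cast m.factorial_ne_zero

end Characters

/-! ### Frobenius' character formula and orthonormality -/

section Frobenius

variable {m : ℕ}

/-- The exponents `λ_i + ℓ - i`. -/
def shifted (lam : m.Partition) (i : Fin (rows lam).length) : ℕ := (rows lam)[i] + i.rev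

theorem sum_shifted (lam : m.Partition) :
    ∑ i, shifted lam i = m + ∑ i : Fin (rows lam).length, (i : ℕ) := by
  have h : ∑ i : Fin (rows lam).length, (i.rev : ℕ) = ∑ i : Fin (rows lam).length, (i : ℕ) :=
    Equiv.sum_comp Fin.revPerm (fun i : Fin (rows lam).length => (i : ℕ))
  simp only [shifted]
  rw [Finset.sum_add_distrib, h, sum_rows lam]

theorem shifted_injective (lam : m.Partition) : Function.Injective (shifted lam) := by
  refine StrictAnti.injective fun i j h => ?_
  have h1 := rows_antitone lam h.le
  have h2 : (j.rev : ℕ) < i.rev := Fin.rev_lt_rev.2 h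
  simp only [shifted]
  omega

/-- The sum of the row indices of the boxes of `λ`. -/
def depth (lam : m.Partition) : ℕ := ∑ k, row lam k

theorem depth_eq (lam : m.Partition) :
    depth lam = ∑ i : Fin (rows lam).length, (rows lam)[i] * i := by
  have := sum_word_eq (rowFin lam)
  simp only [content_rowFin] at this
  exact this

/-- The letter `i` occurs `μ_i + s i - i` times, and `2 ∑ i (s i - i) = -∑ (s i - i)²` because `s`
preserves the sum of squares. So `s ≠ 1` strictly lowers the letter sum below the depth. -/
theorem sum_word_add_eq (mu : m.Partition) (s : Equiv.Perm (Fin (rows mu).length))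
    (hs : ∀ i, ((s i).rev : ℕ) ≤ shifted mu i) (f : Fin m → Fin (rows mu).length)
    (hf : content f = fun i => shifted mu i - (s i).rev) :
    2 * (∑ k, (f k : ℤ)) + ∑ i, ((s i : ℤ) - i) ^ 2 = 2 * depth mu := by
  have h1 : (∑ k, (f k : ℤ)) = ∑ i : Fin (rows mu).length,
      (((rows mu)[i] : ℕ) * ((i : ℕ) : ℤ) + ((s i : ℤ) - i) * (i : ℕ)) := by
    rw [← Nat.cast_sum, sum_word_eq, Nat.cast_sum]
    refine Finset.sum_congr rfl fun i _ => ?_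
    have h2 : (content f i : ℤ) = ((rows mu)[i] : ℕ) + ((s i : ℤ) - i) := by
      rw [hf, Nat.cast_sub (hs i), shifted, Nat.cast_add, Fin.val_rev, Fin.val_rev,
        Nat.cast_sub (by omega), Nat.cast_sub (by omega)]
      push_cast
      ring
    rw [Nat.cast_mul, h2]
    ring
  have h3 : ∑ i, ((s i : ℕ) : ℤ) ^ 2 = ∑ i : Fin (rows mu).length, ((i : ℕ) : ℤ) ^ 2 :=
    Equiv.sum_comp s fun i : Fin (rows mu).length => ((i : ℕ) : ℤ) ^ 2
  rw [h1, depth_eq, Finset.sum_add_distrib]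
  have h4 : ∑ i, ((s i : ℤ) - i) ^ 2 = ∑ i, ((s i : ℕ) : ℤ) ^ 2 -
      ∑ i : Fin (rows mu).length, ((i : ℕ) : ℤ) ^ 2 -
      2 * ∑ i, ((s i : ℤ) - i) * (i : ℤ) := by
    rw [Finset.mul_sum, ← Finset.sum_sub_distrib, ← Finset.sum_sub_distrib]
    exact Finset.sum_congr rfl fun i _ => by ring
  rw [h4, h3]
  push_cast
  ring

theorem eq_one_of_sum_sq_eq_zero {n : ℕ} {s : Equiv.Perm (Fin n)}
    (h : ∑ i, ((s i : ℤ) - i) ^ 2 = 0) : s = 1 := by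
  rw [Finset.sum_eq_zero_iff_of_nonneg fun i _ => sq_nonneg _] at h
  ext i
  have := pow_eq_zero_iff two_ne_zero |>.1 (h i (mem_univ i))
  simp only [Equiv.Perm.one_apply]
  omega

theorem eq_of_content_eq {lam mu : m.Partition} {f : Fin m → Fin (rows mu).length}
    (hf : content f = fun i => (rows mu)[i]) {q : Equiv.Perm (Fin m)}
    (hq : ∀ k, row lam (q k) = f k) : lam = mu := by
  have hc : ∀ (nu : m.Partition) (i : ℕ), #{k | row nu k = i} = (rows nu)[i]?.getD 0 := by
    intro nu i
    by_cases hi : i < (rows nu).length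
    · rw [List.getElem?_eq_getElem hi, Option.getD_some]
      refine Eq.trans ?_ (content_rowFin nu ⟨i, hi⟩)
      rw [content]
      congr 1
      ext k
      rw [mem_filter, mem_filter, Fin.ext_iff]
      rfl
    · rw [List.getElem?_eq_none (not_lt.1 hi), Option.getD_none, card_eq_zero,
        filter_eq_empty_iff]
      intro k _ hk
      exact hi (hk ▸ (rowFin nu k).2)
  have h1 : ∀ i : ℕ, (rows lam)[i]?.getD 0 = (rows mu)[i]?.getD 0 := by
    intro i
    rw [← hc lam, ← Finset.card_equiv (s := {k | (f k : ℕ) = i}) q (by simp [hq])]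
    by_cases hi : i < (rows mu).length
    · rw [List.getElem?_eq_getElem hi, Option.getD_some]
      refine Eq.trans ?_ (congrFun hf ⟨i, hi⟩)
      rw [content]
      congr 1
      ext k
      simp [Fin.ext_iff]
    · rw [List.getElem?_eq_none (not_lt.1 hi), Option.getD_none, card_eq_zero,
        filter_eq_empty_iff]
      intro k _ hk
      exact hi (hk ▸ (f k).2)
  have h2 : rows lam = rows mu := by
    refine List.ext_getElem? fun i => ?_
    have h := h1 i
    have p1 := fun x (hx : (rows lam)[i]? = some x) => rows_pos lam (List.mem_of_getElem? hx)
    have p2 := fun x (hx : (rows mu)[i]? = some x) => rows_pos mu (List.mem_of_getElem? hx)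
    rcases h3 : (rows lam)[i]? with _ | x <;> rcases h4 : (rows mu)[i]? with _ | z
    · rfl
    · have := p2 z h4
      simp [h3, h4] at h
      omega
    · have := p1 x h3
      simp [h3, h4] at h
      omega
    · simpa [h3, h4] using h
  refine Nat.Partition.ext ?_
  rw [← Multiset.sort_eq lam.parts (· ≥ ·), ← Multiset.sort_eq mu.parts (· ≥ ·)]
  exact congrArg _ h2

/-- A column-injective word with this content would have letter sum at least `depth lam ≥ depth mu`,
but at most `depth mu`, with equality only for `s = 1`. The case of equality then identifies the two
shapes. -/
theorem scalarProd_permChar_shifted {lam mu : m.Partition} (h : depth mu ≤ depth lam)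
    {s : Equiv.Perm (Fin (rows mu).length)} (hs : ∀ i, ((s i).rev : ℕ) ≤ shifted mu i)
    (hne : ¬ (s = 1 ∧ lam = mu)) :
    scalarProd (simpleChar lam) (permChar fun i => shifted mu i - (s i).rev) = 0 := by
  refine scalarProd_permChar_eq_zero lam _ fun f hf hinj => hne ?_
  have h1 := sum_word_add_eq mu s hs f hf
  have hinj' : ColInj lam fun k => (f k : ℕ) := fun k l hc e => hinj k l hc (Fin.ext e)
  have h2 : depth lam ≤ ∑ k, (f k : ℕ) := hinj'.sum_row_le lam
  have h3 : 0 ≤ ∑ i, ((s i : ℤ) - i) ^ 2 := Finset.sum_nonneg fun i _ => sq_nonneg _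
  zify at h2 h
  have hs1 : s = 1 := eq_one_of_sum_sq_eq_zero (by linarith)
  refine ⟨hs1, ?_⟩
  obtain ⟨q, -, hq⟩ := hinj'.exists_perm lam (by
    zify
    have : (depth lam : ℤ) = ∑ k, (row lam k : ℤ) := by simp [depth]
    linarith)
  refine eq_of_content_eq (f := f) ?_ hq
  rw [hf, hs1]
  simp [shifted]

/-- The scalar product with a function, as a linear form. -/
def pairing (F : Equiv.Perm (Fin m) → ℚ) : (Equiv.Perm (Fin m) → ℚ) →ₗ[ℚ] ℚ where
  toFun := scalarProd F
  map_add' f g := by simp [scalarProd, mul_add, Finset.sum_add_distrib]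
  map_smul' r f := by
    simp only [scalarProd, Pi.smul_apply, smul_eq_mul, RingHom.id_apply, Finset.mul_sum]
    exact Finset.sum_congr rfl fun g _ => by ring

theorem pairing_apply (F f : Equiv.Perm (Fin m) → ℚ) : pairing F f = scalarProd F f := rfl

theorem frobChar_eq_sum_smul {n : ℕ} (a : Fin n → ℕ) :
    (frobChar a : Equiv.Perm (Fin m) → ℚ) = ∑ s : Equiv.Perm (Fin n),
      ((Equiv.Perm.sign s : ℤ) : ℚ) •
        if ∀ i, ((s i).rev : ℕ) ≤ a i then permChar (fun i => a i - (s i).rev) else 0 := by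
  ext g
  rw [frobChar_eq_sum, Finset.sum_apply]
  refine Finset.sum_congr rfl fun s _ => ?_
  split_ifs <;> simp

theorem scalarProd_frobChar {lam mu : m.Partition} (h : depth mu ≤ depth lam) :
    scalarProd (simpleChar lam) (frobChar (shifted mu)) = if lam = mu then 1 else 0 := by
  rw [frobChar_eq_sum_smul, ← pairing_apply, map_sum, Finset.sum_eq_single 1]
  · rw [map_smul, if_pos fun i => by simp [shifted], pairing_apply]
    split_ifs with hlm
    · subst hlm
      have e : (fun i => shifted lam i - ((1 : Equiv.Perm (Fin (rows lam).length)) i).rev) =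
          content (rowFin lam) := by
        ext i
        simp [shifted, content_rowFin]
      rw [e, scalarProd_permChar_self]
      simp
    · rw [scalarProd_permChar_shifted h (fun i => by simp [shifted]) fun h => hlm h.2, smul_zero]
  · intro s _ hs
    rw [map_smul]
    split_ifs with h1
    · rw [pairing_apply, scalarProd_permChar_shifted h h1 fun h => hs h.1, smul_zero]
    · simp
  · simp

/-- Frobenius' character formula. -/
theorem simpleChar_eq_frobChar (lam : m.Partition) :
    simpleChar lam = frobChar (shifted lam) := by
  have hm : (m.factorial : ℚ) ≠ 0 := by exact_mod_cast m.factorial_ne_zero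
  have hS : ∀ F : Equiv.Perm (Fin m) → ℚ, scalarProd (simpleChar lam) F =
      (m.factorial : ℚ)⁻¹ * ∑ g, simpleChar lam g * F g⁻¹ := by
    intro F
    rw [scalarProd, Fintype.card_perm, Fintype.card_fin]
  have h1 := scalarProd_simpleChar_self lam
  have h2 := scalarProd_frobChar (le_refl (depth lam))
  have h3 := sum_frobChar_sq (shifted lam) (sum_shifted lam) (shifted_injective lam)
  rw [hS, inv_mul_eq_one₀ hm] at h1
  rw [if_pos rfl, hS, inv_mul_eq_one₀ hm] at h2
  simp only [simpleChar_inv, frobChar_inv] at h1 h2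
  -- Up to the factor `m!`, this is `1 - 2 + 1`; the values are rational, so every square vanishes.
  have h4 : ∑ g, (simpleChar lam g - frobChar (shifted lam) g) ^ 2 = 0 := by
    have : ∀ g, (simpleChar lam g - frobChar (shifted lam) g) ^ 2 =
        simpleChar lam g * simpleChar lam g - 2 * (simpleChar lam g * frobChar (shifted lam) g) +
        frobChar (shifted lam) g * frobChar (shifted lam) g := fun g => by ring
    simp_rw [this]
    rw [Finset.sum_add_distrib, Finset.sum_sub_distrib, ← Finset.mul_sum, ← h1, ← h2, h3]
    ring
  ext g
  have := (Finset.sum_eq_zero_iff_of_nonneg fun g _ => sq_nonneg _).1 h4 g (mem_univ g)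
  exact sub_eq_zero.1 (pow_eq_zero_iff two_ne_zero |>.1 this)

theorem scalarProd_comm (lam mu : m.Partition) :
    scalarProd (simpleChar lam) (simpleChar mu) = scalarProd (simpleChar mu) (simpleChar lam) := by
  simp only [scalarProd, simpleChar_inv]
  congr 1
  exact Finset.sum_congr rfl fun g _ => mul_comm _ _

theorem scalarProd_simpleChar (lam mu : m.Partition) :
    scalarProd (simpleChar lam) (simpleChar mu) = if lam = mu then 1 else 0 := by
  rcases le_total (depth mu) (depth lam) with h | h
  · rw [simpleChar_eq_frobChar mu, scalarProd_frobChar h]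
  · rw [scalarProd_comm, simpleChar_eq_frobChar lam, scalarProd_frobChar h]
    simp only [eq_comm]

theorem linearIndependent_simpleChar :
    LinearIndependent ℚ (simpleChar : m.Partition → Equiv.Perm (Fin m) → ℚ) := by
  rw [Fintype.linearIndependent_iff]
  intro c hc lam
  have := congrArg (pairing (simpleChar lam)) hc
  rw [map_zero, map_sum] at this
  simpa [pairing_apply, scalarProd_simpleChar] using this

/-- Class functions factor through the cycle type, so their space has dimension at most the number
of partitions, which is already the number of independent simple characters. -/
theorem mem_span_simpleChar {F : Equiv.Perm (Fin m) → ℚ} (hF : ∀ g h, IsConj g h → F g = F h) :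
    F ∈ Submodule.span ℚ (Set.range (simpleChar : m.Partition → Equiv.Perm (Fin m) → ℚ)) := by
  let L := LinearMap.funLeft ℚ ℚ (fun g : Equiv.Perm (Fin m) => g.partition)
  have hL : ∀ F : Equiv.Perm (Fin m) → ℚ, (∀ g h, IsConj g h → F g = F h) →
      F ∈ LinearMap.range L := by
    intro F hF
    classical
    refine ⟨fun p => if h : ∃ g : Equiv.Perm (Fin m), g.partition = p then F h.choose else 0, ?_⟩
    ext g
    have h : ∃ g' : Equiv.Perm (Fin m), g'.partition = g.partition := ⟨g, rfl⟩
    simp only [L, LinearMap.funLeft_apply, dif_pos h]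
    exact hF _ _ (Equiv.Perm.partition_eq_of_isConj.2 h.choose_spec)
  have hle : Submodule.span ℚ (Set.range (simpleChar : m.Partition → Equiv.Perm (Fin m) → ℚ)) ≤
      LinearMap.range L := by
    rw [Submodule.span_le]
    rintro _ ⟨lam, rfl⟩
    refine hL _ fun g h hgh => ?_
    obtain ⟨c, rfl⟩ := isConj_iff.1 hgh
    exact (simpleChar_conj lam g c).symm
  rw [Submodule.eq_of_le_of_finrank_le hle]
  · exact hL F hF
  · rw [finrank_span_eq_card linearIndependent_simpleChar]
    refine (LinearMap.finrank_range_le L).trans (le_of_eq ?_)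
    rw [Module.finrank_fintype_fun_eq_card]
    exact congrArg (fun n : ℕ => Fintype.card n.Partition) (Fintype.card_fin m)

theorem eq_sum_scalarProd_smul {F : Equiv.Perm (Fin m) → ℚ} (hF : ∀ g h, IsConj g h → F g = F h) :
    F = ∑ lam : m.Partition, scalarProd (simpleChar lam) F • simpleChar lam := by
  obtain ⟨c, rfl⟩ := (Submodule.mem_span_range_iff_exists_fun ℚ).1 (mem_span_simpleChar hF)
  refine Finset.sum_congr rfl fun lam _ => ?_
  congr 1
  rw [← pairing_apply, map_sum]
  simp [pairing_apply, scalarProd_simpleChar]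

end Frobenius

/-! ### Weights of polynomials and excess -/

section Weights

/-- The weight of a monomial. -/
abbrev wt (s : ℕ+ →₀ ℕ) : ℕ := Finsupp.weight (fun i : ℕ+ => (i : ℕ)) s

theorem mem_polyLE {d : ℕ} {P : CyclePoly} : P ∈ polyLE d ↔ ∀ s ∈ P.support, wt s ≤ d := by
  rw [polyLE, mem_restrictSupport_iff]
  rfl

theorem mem_polyLE_iff_polyWeight_le {d : ℕ} {P : CyclePoly} : P ∈ polyLE d ↔ polyWeight P ≤ d := by
  rw [mem_polyLE, polyWeight, weightedTotalDegree, Finset.sup_le_iff]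

theorem polyLE_mono {d e : ℕ} (h : d ≤ e) : polyLE d ≤ polyLE e := fun _ hP =>
  mem_polyLE.2 fun s hs => (mem_polyLE.1 hP s hs).trans h

theorem C_mem_polyLE (r : ℚ) (d : ℕ) : (C r : CyclePoly) ∈ polyLE d := by
  refine mem_polyLE.2 fun s hs => ?_
  have : s = 0 := by
    by_contra h
    rw [mem_support_iff, coeff_C, if_neg (Ne.symm h)] at hs
    exact hs rfl
  simp [this]

theorem X_mem_polyLE (i : ℕ+) : (X i : CyclePoly) ∈ polyLE i := by
  refine mem_polyLE.2 fun s hs => ?_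
  rw [support_X, mem_singleton] at hs
  simp [hs, wt, Finsupp.weight_single]

theorem exists_of_mem_support_mul {P Q : CyclePoly} {s : ℕ+ →₀ ℕ} (hs : s ∈ (P * Q).support) :
    ∃ a ∈ P.support, ∃ b ∈ Q.support, wt s = wt a + wt b := by
  classical
  obtain ⟨a, ha, b, hb, rfl⟩ := Finset.mem_add.1 (support_mul P Q hs)
  exact ⟨a, ha, b, hb, map_add _ a b⟩

theorem mul_mem_polyLE {d e : ℕ} {P Q : CyclePoly} (hP : P ∈ polyLE d) (hQ : Q ∈ polyLE e) :
    P * Q ∈ polyLE (d + e) := by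
  refine mem_polyLE.2 fun s hs => ?_
  obtain ⟨a, ha, b, hb, h⟩ := exists_of_mem_support_mul hs
  rw [h]
  exact add_le_add (mem_polyLE.1 hP a ha) (mem_polyLE.1 hQ b hb)

theorem prod_mem_polyLE {ι : Type*} (S : Finset ι) (k : ι → ℕ) (P : ι → CyclePoly)
    (h : ∀ i ∈ S, P i ∈ polyLE (k i)) : ∏ i ∈ S, P i ∈ polyLE (∑ i ∈ S, k i) := by
  classical
  induction S using Finset.induction_on with
  | empty => simpa using C_mem_polyLE 1 0
  | insert a S ha ih =>
    rw [Finset.prod_insert ha, Finset.sum_insert ha]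
    exact mul_mem_polyLE (h a (mem_insert_self _ _)) (ih fun i hi => h i (mem_insert_of_mem hi))

theorem binomX_mem_polyLE (d : ℕ+) (j : ℕ) : binomX d j ∈ polyLE (j * d) := by
  rw [binomX, ← zero_add (j * (d : ℕ))]
  refine mul_mem_polyLE (C_mem_polyLE _ _) ?_
  have := prod_mem_polyLE (range j) (fun _ => (d : ℕ)) (fun t => (X d - C (t : ℚ) : CyclePoly))
    fun t _ => (polyLE d).sub_mem (X_mem_polyLE d) (C_mem_polyLE _ _)
  simpa using this

/-- A polynomial with coefficients in `CyclePoly` has excess at least `k` if the weight of each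
coefficient, increased by `k`, is at most the degree of its monomial. -/
def Excess {σ : Type*} (k : ℕ) (G : MvPolynomial σ CyclePoly) : Prop :=
  ∀ e, ∀ s ∈ (coeff e G).support, wt s + k ≤ e.degree

variable {σ : Type*}

theorem Excess.sum {ι : Type*} {k : ℕ} (S : Finset ι) (G : ι → MvPolynomial σ CyclePoly)
    (h : ∀ i ∈ S, Excess k (G i)) : Excess k (∑ i ∈ S, G i) := by
  classical
  intro e s hs
  rw [coeff_sum] at hs
  obtain ⟨i, hi, hs⟩ := Finset.mem_biUnion.1 (MvPolynomial.support_sum hs)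
  exact h i hi e s hs

theorem Excess.sub {k : ℕ} {G H : MvPolynomial σ CyclePoly} (hG : Excess k G) (hH : Excess k H) :
    Excess k (G - H) := by
  classical
  intro e s hs
  rw [coeff_sub] at hs
  rcases Finset.mem_union.1 (support_sub _ _ _ hs) with h | h
  · exact hG e s h
  · exact hH e s h

theorem Excess.mul {k l : ℕ} {G H : MvPolynomial σ CyclePoly} (hG : Excess k G) (hH : Excess l H) :
    Excess (k + l) (G * H) := by
  classical
  intro e s hs
  rw [coeff_mul] at hs
  obtain ⟨p, hp, hs⟩ := Finset.mem_biUnion.1 (MvPolynomial.support_sum hs)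
  obtain ⟨a, ha, b, hb, h⟩ := exists_of_mem_support_mul hs
  have h1 := hG _ a ha
  have h2 := hH _ b hb
  rw [h, ← mem_antidiagonal.1 hp, map_add]
  omega

theorem Excess.monomial {k : ℕ} {e : σ →₀ ℕ} {P : CyclePoly}
    (h : ∀ s ∈ P.support, wt s + k ≤ e.degree) :
    Excess k (MvPolynomial.monomial e P) := by
  classical
  intro e' s hs
  rw [coeff_monomial] at hs
  split_ifs at hs with he
  · exact he ▸ h s hs
  · simp at hs

theorem wt_eq_zero_of_mem_support_one {s : ℕ+ →₀ ℕ} (hs : s ∈ (1 : CyclePoly).support) :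
    wt s = 0 := by
  rw [support_one, mem_singleton] at hs
  simp [hs]

theorem Excess.one : Excess 0 (1 : MvPolynomial σ CyclePoly) :=
  Excess.monomial fun s hs => by simp [wt_eq_zero_of_mem_support_one hs]

theorem Excess.X_pow (i : σ) (d : ℕ) : Excess d (X i ^ d : MvPolynomial σ CyclePoly) := by
  rw [X_pow_eq_monomial]
  exact Excess.monomial fun s hs => by simp [wt_eq_zero_of_mem_support_one hs]

theorem Excess.of_le {k l : ℕ} (h : k ≤ l) {G : MvPolynomial σ CyclePoly} (hG : Excess l G) :
    Excess k G := fun e s hs => (Nat.add_le_add_left h _).trans (hG e s hs)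

theorem Excess.prod {ι : Type*} (S : Finset ι) (k : ι → ℕ) (G : ι → MvPolynomial σ CyclePoly)
    (h : ∀ i ∈ S, Excess (k i) (G i)) : Excess (∑ i ∈ S, k i) (∏ i ∈ S, G i) := by
  classical
  induction S using Finset.induction_on with
  | empty => simpa using Excess.one
  | insert a S ha ih =>
    rw [Finset.prod_insert ha, Finset.sum_insert ha]
    exact (h a (mem_insert_self _ _)).mul (ih fun i hi => h i (mem_insert_of_mem hi))

theorem Excess.pow {k : ℕ} {G : MvPolynomial σ CyclePoly} (hG : Excess k G) (j : ℕ) :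
    Excess (j * k) (G ^ j) := by
  simpa using Excess.prod (range j) (fun _ => k) (fun _ => G) fun _ _ => hG

theorem Excess.C_mul {k : ℕ} {P : CyclePoly} {G : MvPolynomial σ CyclePoly} (hP : P ∈ polyLE k)
    (hG : Excess k G) : Excess 0 (C P * G) := by
  intro e s hs
  rw [coeff_C_mul] at hs
  obtain ⟨a, ha, b, hb, h⟩ := exists_of_mem_support_mul hs
  have h1 := mem_polyLE.1 hP a ha
  have h2 := hG e b hb
  omega

theorem Excess.coeff_eq_zero {k : ℕ} {G : MvPolynomial σ CyclePoly} (hG : Excess k G) {e : σ →₀ ℕ}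
    (he : e.degree < k) : coeff e G = 0 := by
  by_contra h
  obtain ⟨s, hs⟩ := support_nonempty.2 h
  have := hG e s hs
  omega

end Weights

/-! ### The weight of a Frobenius polynomial -/

section FrobeniusWeight

variable {m : ℕ} (lam : m.Partition)

theorem length_pos (hm : 0 < m) : 0 < (rows lam).length := by
  by_contra h
  have h0 : IsEmpty (Fin (rows lam).length) := ⟨fun i => h i.pos⟩
  have := sum_rows lam
  rw [Finset.sum_of_isEmpty] at this
  omega

theorem powerSum_sub_one_excess (hl : 0 < (rows lam).length) (d : ℕ) :
    Excess d (powerSum lam d - 1) := by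
  have h : powerSum lam d - 1 = ∑ i ∈ univ.erase ⟨0, hl⟩, yVar lam i ^ d := by
    rw [powerSum, ← Finset.add_sum_erase univ _ (mem_univ ⟨0, hl⟩)]
    simp [yVar]
  rw [h]
  refine Excess.sum _ _ fun i hi => ?_
  have : (i : ℕ) ≠ 0 := fun h0 => (mem_erase.1 hi).1 (Fin.ext h0)
  rw [yVar, if_neg this]
  exact Excess.X_pow i d

theorem powerSumPow_excess (hl : 0 < (rows lam).length) (d : ℕ+) :
    Excess 0 (powerSumPow lam d) :=
  Excess.sum _ _ fun j _ => Excess.C_mul (binomX_mem_polyLE d j)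
    ((powerSum_sub_one_excess lam hl d).pow j)

theorem prod_powerSumPow_excess :
    Excess 0 (∏ d ∈ range m, powerSumPow lam d.succPNat) := by
  rcases m.eq_zero_or_pos with rfl | hm
  · simpa using Excess.one
  · simpa using Excess.prod (range m) (fun _ => 0) _ fun d _ =>
      powerSumPow_excess lam (length_pos lam hm) d.succPNat

/-- The order of the discriminant at `y₁ = 1`. -/
def discrOrder : ℕ :=
  ∑ i : Fin (rows lam).length, if (i : ℕ) = 0 then 0 else (rows lam).length - 1 - i

theorem yVar_excess (i : Fin (rows lam).length) :
    Excess (if (i : ℕ) = 0 then 0 else 1) (yVar lam i) := by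
  rw [yVar]
  split_ifs
  · exact Excess.one
  · simpa using Excess.X_pow i 1

theorem discr_excess : Excess (discrOrder lam) (discr lam) := by
  refine Excess.prod _ _ _ fun i _ => ?_
  have h := Excess.prod (Ioi i) (fun _ => if (i : ℕ) = 0 then 0 else 1)
    (fun j => yVar lam i - yVar lam j) fun j hj => by
      refine (yVar_excess lam i).sub ((yVar_excess lam j).of_le ?_)
      have : i < j := mem_Ioi.1 hj
      have : (i : ℕ) < j := this
      split_ifs <;> omega
  simp only [Finset.sum_const, Fin.card_Ioi, smul_eq_mul, mul_ite, mul_zero, mul_one] at h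
  exact h

theorem sum_tail_eq (l : List ℕ) :
    ∑ i : Fin l.length, (if (i : ℕ) = 0 then 0 else l[i]) = l.tail.sum := by
  cases l with
  | nil => rfl
  | cons a l =>
    refine (Fin.sum_univ_succ _).trans ?_
    simp

theorem degree_frobExponent : (frobExponent lam).degree = weight lam + discrOrder lam := by
  rw [Finsupp.degree_eq_sum, weight, ← sum_tail_eq, discrOrder, ← Finset.sum_add_distrib]
  refine Finset.sum_congr rfl fun i _ => ?_
  simp only [frobExponent, Finsupp.equivFunOnFinite_symm_apply_apply]
  split_ifs <;> rfl

/-- The discriminant has excess `discrOrder` and the powers have excess `0`, while the extracted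
monomial has degree only `weight lam + discrOrder`; the difference bounds the weight of the
coefficient. -/
theorem frobPoly_mem_polyLE : frobPoly lam ∈ polyLE (weight lam) := by
  refine mem_polyLE.2 fun s hs => ?_
  have := ((discr_excess lam).mul (prod_powerSumPow_excess lam)) _ s hs
  rw [degree_frobExponent] at this
  omega

end FrobeniusWeight

/-! ### Frobenius polynomials at cycle counts -/

section Evaluation

variable {m : ℕ}

/-- Evaluation of polynomials at the cycle counts of a permutation. -/
def evalCycles (g : Equiv.Perm (Fin m)) : CyclePoly →ₐ[ℚ] ℚ :=
  aeval fun i => (cycleCount m i g : ℚ)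

theorem rho_apply (P : CyclePoly) (g : Equiv.Perm (Fin m)) : rho m P g = evalCycles g P := by
  have : (Pi.evalAlgHom ℚ (fun _ : Equiv.Perm (Fin m) => ℚ) g).comp (rho m) = evalCycles g :=
    MvPolynomial.algHom_ext fun i => by simp [rho, evalCycles]
  exact congrArg (fun T => T P) this

theorem prod_sub_eq_descFactorial (x j : ℕ) :
    ∏ t ∈ range j, ((x : ℚ) - t) = x.descFactorial j := by
  induction j with
  | zero => simp
  | succ j ih =>
    rw [Finset.prod_range_succ, ih, Nat.descFactorial_succ, Nat.cast_mul, mul_comm]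
    rcases le_or_gt j x with h | h
    · rw [Nat.cast_sub h]
    · rw [Nat.descFactorial_of_lt h]
      simp

theorem evalCycles_binomX (g : Equiv.Perm (Fin m)) (d : ℕ+) (j : ℕ) :
    evalCycles g (binomX d j) = (cycleCount m d g).choose j := by
  have h : (j.factorial : ℚ) ≠ 0 := by exact_mod_cast j.factorial_ne_zero
  have h2 : evalCycles g (binomX d j) =
      (j.factorial : ℚ)⁻¹ * ∏ t ∈ range j, ((cycleCount m d g : ℚ) - t) := by
    simp [binomX, evalCycles, map_prod]
  rw [h2, prod_sub_eq_descFactorial, Nat.descFactorial_eq_factorial_mul_choose, Nat.cast_mul,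
    inv_mul_cancel_left₀ h]

variable {n : ℕ}

/-- The substitution `y₁ = 1`. -/
def dehom (n : ℕ) : MvPolynomial (Fin n) ℚ →ₐ[ℚ] MvPolynomial (Fin n) ℚ :=
  aeval fun i => if (i : ℕ) = 0 then 1 else X i

/-- The exponent obtained by forgetting the first variable. -/
def eraseZero (e : Fin n →₀ ℕ) : Fin n →₀ ℕ :=
  Finsupp.equivFunOnFinite.symm fun i => if (i : ℕ) = 0 then 0 else e i

theorem dehom_monomial (e : Fin n →₀ ℕ) (r : ℚ) :
    dehom n (monomial e r) = monomial (eraseZero e) r := by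
  rw [dehom, aeval_monomial, monomial_eq, Finsupp.prod_fintype _ _ (by simp),
    Finsupp.prod_fintype _ _ (by simp)]
  congr 1
  refine Finset.prod_congr rfl fun i _ => ?_
  simp only [eraseZero, Finsupp.equivFunOnFinite_symm_apply_apply]
  split_ifs <;> simp

theorem coeff_dehom (b : Fin n →₀ ℕ) (F : MvPolynomial (Fin n) ℚ) :
    coeff b (dehom n F) = ∑ e ∈ F.support, if eraseZero e = b then coeff e F else 0 := by
  conv_lhs => rw [F.as_sum, map_sum, coeff_sum]
  exact Finset.sum_congr rfl fun e _ => by rw [dehom_monomial, coeff_monomial]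

theorem eq_of_eraseZero_eq {e e' : Fin n →₀ ℕ} (h : eraseZero e = eraseZero e')
    (hd : e.degree = e'.degree) : e = e' := by
  have h1 : ∀ i : Fin n, (i : ℕ) ≠ 0 → e i = e' i := fun i hi => by
    have := DFunLike.congr_fun h i
    simpa [eraseZero, hi] using this
  ext i
  by_cases hi : (i : ℕ) = 0
  · rw [Finsupp.degree_eq_sum, Finsupp.degree_eq_sum, ← Finset.add_sum_erase univ _ (mem_univ i),
      ← Finset.add_sum_erase univ (fun i => e' i) (mem_univ i), Finset.sum_congr rfl fun j hj =>
        h1 j fun hj0 => (mem_erase.1 hj).1 (Fin.ext (hj0.trans hi.symm))] at hd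
    exact Nat.add_right_cancel hd
  · exact h1 i hi

theorem degree_of_isHomogeneous {F : MvPolynomial (Fin n) ℚ} {D : ℕ} (hF : F.IsHomogeneous D)
    {e : Fin n →₀ ℕ} (he : coeff e F ≠ 0) : e.degree = D := by
  exact (DFunLike.congr_fun (Finsupp.degree_eq_weight_one (R := ℕ)) e).trans (hF he)

/-- Under homogeneity the exponent of `y₁` is determined by the others, so no two monomials merge at
`y₁ = 1`. -/
theorem coeff_dehom_eraseZero {F : MvPolynomial (Fin n) ℚ} {e : Fin n →₀ ℕ}
    (hF : F.IsHomogeneous e.degree) : coeff (eraseZero e) (dehom n F) = coeff e F := by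
  rw [coeff_dehom, Finset.sum_eq_single e]
  · simp
  · intro e' he' hne
    rw [if_neg]
    intro h
    exact hne (eq_of_eraseZero_eq h (degree_of_isHomogeneous hF (mem_support_iff.1 he')))
  · intro h
    simpa using h

theorem cycleProd_isHomogeneous (g : Equiv.Perm (Fin m)) : (cycleProd n g).IsHomogeneous m := by
  rw [cycleProd_eq_sum]
  refine IsHomogeneous.sum _ _ _ fun f _ => isHomogeneous_monomial _ ?_
  rw [Finsupp.degree_eq_sum]
  exact sum_content f

theorem prod_sub_isHomogeneous :
    (∏ i, ∏ j ∈ Ioi i, (X i - X j) : MvPolynomial (Fin n) ℚ).IsHomogeneous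
      (∑ i : Fin n, (i : ℕ)) := by
  rw [prod_sub_eq_sum]
  refine IsHomogeneous.sum _ _ _ fun s _ => isHomogeneous_monomial _ ?_
  rw [Finsupp.degree_eq_sum]
  exact Equiv.sum_comp (s.trans Fin.revPerm) (fun i : Fin n => (i : ℕ))

/-- If `M ≥ m`, the truncations in the definition of the Frobenius polynomials of the partitions
of `M` have no effect at an element of `S_m`. -/
theorem map_prod_powerSumPow {M : ℕ} (mu : M.Partition) (hM : m ≤ M) (g : Equiv.Perm (Fin m)) :
    map (evalCycles g : CyclePoly →+* ℚ) (∏ d ∈ range M, powerSumPow mu d.succPNat) =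
      dehom _ (cycleProd _ g) := by
  let P : ℕ → MvPolynomial (Fin (rows mu).length) ℚ := fun d => dehom _ (∑ i, X i ^ d)
  have hP : ∀ d, map (evalCycles g : CyclePoly →+* ℚ) (powerSum mu d) = P d := by
    intro d
    simp only [P, powerSum, yVar, dehom, map_sum, map_pow, aeval_X]
    exact Finset.sum_congr rfl fun i _ => by split_ifs <;> simp
  -- There are at most `m ≤ M` cycles of any length, so the binomial expansion truncated at `M` is
  -- complete.
  have hcard : ∀ d, g.partition.parts.count d ≤ M := fun d => by
    refine (Multiset.count_le_card _ _).trans ?_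
    have h1 : g.partition.parts.sum = m := g.partition.parts_sum.trans (Fintype.card_fin m)
    have h2 : Multiset.card g.partition.parts • 1 ≤ g.partition.parts.sum :=
      Multiset.card_nsmul_le_sum fun x hx => g.partition.parts_pos hx
    simp only [smul_eq_mul, mul_one] at h2
    omega
  have h1 : ∀ d : ℕ+, map (evalCycles g : CyclePoly →+* ℚ) (powerSumPow mu d) =
      P d ^ g.partition.parts.count (d : ℕ) := by
    intro d
    have hx := hcard d
    have h2 : P d ^ g.partition.parts.count (d : ℕ) =
        ∑ j ∈ range (M + 1), C ((cycleCount m d g).choose j : ℚ) * (P d - 1) ^ j := by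
      conv_lhs => rw [← sub_add_cancel (P d) 1, add_pow]
      refine (Finset.sum_subset (range_mono (Nat.succ_le_succ hx)) fun j _ hj => ?_).trans
        (Finset.sum_congr rfl fun j _ => ?_)
      · rw [Nat.choose_eq_zero_of_lt (by simpa using hj)]
        simp
      · simp [cycleCount, mul_comm]
    rw [h2, powerSumPow, map_sum]
    refine Finset.sum_congr rfl fun j _ => ?_
    rw [map_mul, map_C, map_pow, map_sub, hP, map_one]
    congr 2
    exact evalCycles_binomX g d j
  rw [map_prod, Finset.prod_congr rfl fun d _ => h1 d.succPNat, cycleProd, map_multiset_prod,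
    Multiset.map_map]
  change _ = (g.partition.parts.map P).prod
  have hsub : g.partition.parts.toFinset ⊆ (range M).image Nat.succ := by
    intro d hd
    rw [Multiset.mem_toFinset] at hd
    have h2 := g.partition.parts_pos hd
    have h3 := Multiset.single_le_sum (fun _ _ => Nat.zero_le _) d hd
    have h4 : g.partition.parts.sum = m := g.partition.parts_sum.trans (Fintype.card_fin m)
    exact mem_image.2 ⟨d - 1, mem_range.2 (by omega), by omega⟩
  rw [Finset.prod_multiset_map_count, Finset.prod_subset hsub]
  · rw [Finset.prod_image fun a _ b _ h => Nat.succ_injective h]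
    rfl
  · intro d _ hd
    rw [Multiset.count_eq_zero_of_notMem (by simpa using hd), pow_zero]

theorem map_discr {M : ℕ} (mu : M.Partition) (g : Equiv.Perm (Fin m)) :
    map (evalCycles g : CyclePoly →+* ℚ) (discr mu) =
      dehom _ (∏ i, ∏ j ∈ Ioi i, (X i - X j)) := by
  have h : ∀ i, map (evalCycles g : CyclePoly →+* ℚ) (yVar mu i) = dehom _ (X i) := by
    intro i
    rw [dehom, aeval_X, yVar]
    split_ifs <;> simp
  simp only [discr, map_prod, map_sub, h]

/-- The Frobenius polynomial of `λ` takes the values of the character of the simple module. -/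
theorem rho_frobPoly (lam : m.Partition) : rho m (frobPoly lam) = simpleChar lam := by
  rw [simpleChar_eq_frobChar]
  ext g
  rw [rho_apply, frobPoly]
  change (evalCycles g : CyclePoly →+* ℚ) _ = _
  have he : frobExponent lam = eraseZero (expo (shifted lam)) := by
    ext i
    simp only [frobExponent, eraseZero, Finsupp.equivFunOnFinite_symm_apply_apply, shifted,
      Fin.val_rev]
    split_ifs
    · rfl
    · omega
  rw [← coeff_map, map_mul, map_prod_powerSumPow lam le_rfl, map_discr, ← map_mul, he,
    coeff_dehom_eraseZero, frobChar]
  have h := prod_sub_isHomogeneous.mul (cycleProd_isHomogeneous (n := (rows lam).length) g)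
  convert h using 1
  rw [Finsupp.degree_eq_sum, add_comm]
  exact sum_shifted lam

end Evaluation

/-! ### Partitions, monomials and bases of Frobenius polynomials -/

section Counting

variable {m : ℕ}

theorem headD_add_weight (lam : m.Partition) : (rows lam).headD 0 + weight lam = m := by
  have h : (rows lam).sum = m := by
    rw [← Multiset.sum_coe, rows, Multiset.sort_eq, lam.parts_sum]
  rw [weight]
  cases h1 : rows lam with
  | nil => rw [h1] at h; simpa using h
  | cons a l => rw [h1] at h; simpa using h

theorem rows_eq_cons (lam : m.Partition) (hm : 0 < m) :
    rows lam = (m - weight lam) :: (rows lam).tail := by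
  have h := headD_add_weight lam
  have hl := length_pos lam hm
  cases h1 : rows lam with
  | nil => rw [h1] at hl; simp at hl
  | cons a l =>
    rw [h1] at h
    simp only [List.headD_cons] at h
    simp only [List.tail_cons, List.cons.injEq, and_true]
    omega

theorem weight_lt (lam : m.Partition) (hm : 0 < m) : weight lam < m := by
  have h := rows_pos lam (x := m - weight lam) (by rw [rows_eq_cons lam hm]; simp)
  omega

theorem wt_toFinsupp (t : Multiset ℕ+) :
    wt (Multiset.toFinsupp t) = (t.map fun i : ℕ+ => (i : ℕ)).sum := by
  induction t using Multiset.induction_on with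
  | empty => simp
  | cons a t ih =>
    rw [← Multiset.singleton_add, map_add, wt, map_add, Multiset.toFinsupp_singleton,
      Finsupp.weight_single, Multiset.map_add, Multiset.sum_add, ← ih]
    simp

/-- The monomial whose exponents are the multiplicities of the parts `λ₂, λ₃, …`. -/
def tailMonomial (lam : m.Partition) : ℕ+ →₀ ℕ :=
  Multiset.toFinsupp (((rows lam).tail.map Nat.toPNat' : List ℕ+) : Multiset ℕ+)

theorem map_coe_toPNat' (lam : m.Partition) :
    ((((rows lam).tail.map Nat.toPNat' : List ℕ+) : Multiset ℕ+).map fun i : ℕ+ => (i : ℕ)) =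
      ((rows lam).tail : Multiset ℕ) := by
  rw [Multiset.map_coe, List.map_map]
  congr 1
  refine (List.map_congr_left fun x hx => ?_).trans (List.map_id _)
  have := rows_pos lam (List.mem_of_mem_tail hx)
  simp [Nat.toPNat'_coe, this]

theorem wt_tailMonomial (lam : m.Partition) : wt (tailMonomial lam) = weight lam := by
  rw [tailMonomial, wt_toFinsupp, map_coe_toPNat', Multiset.sum_coe, weight]

theorem tailMonomial_injective : Function.Injective (tailMonomial (m := m)) := by
  intro lam mu h
  have hw : weight lam = weight mu := by rw [← wt_tailMonomial, h, wt_tailMonomial]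
  have ht : ((rows lam).tail : Multiset ℕ) = ((rows mu).tail : Multiset ℕ) := by
    rw [← map_coe_toPNat', ← map_coe_toPNat', Multiset.toFinsupp.injective h]
  rcases m.eq_zero_or_pos with rfl | hm
  · exact Subsingleton.elim _ _
  · refine Nat.Partition.ext ?_
    rw [← Multiset.sort_eq lam.parts (· ≥ ·), ← Multiset.sort_eq mu.parts (· ≥ ·)]
    change ((rows lam : List ℕ) : Multiset ℕ) = (rows mu : List ℕ)
    rw [rows_eq_cons lam hm, rows_eq_cons mu hm, ← Multiset.cons_coe, ← Multiset.cons_coe, ht, hw]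

/-- The part `m - wt s ≥ d` is at least as large as every part read off from `s`, so it can be put
in front as first row. -/
theorem exists_tailMonomial_eq {d : ℕ} (hd : 2 * d ≤ m) {s : ℕ+ →₀ ℕ} (hs : wt s ≤ d) :
    ∃ lam : m.Partition, tailMonomial lam = s := by
  obtain ⟨t, rfl⟩ := Multiset.toFinsupp.surjective s
  rw [wt_toFinsupp] at hs
  let t' : Multiset ℕ := t.map fun i : ℕ+ => (i : ℕ)
  have hpos : ∀ x ∈ t', 0 < x := by
    intro x hx
    obtain ⟨i, -, rfl⟩ := Multiset.mem_map.1 hx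
    exact i.pos
  have hle : ∀ x ∈ t', x ≤ t'.sum := Multiset.single_le_sum fun _ _ => Nat.zero_le _
  change t'.sum ≤ d at hs
  -- For `m = 0` the new first part would be `0`, which is not allowed; the empty partition serves
  -- instead.
  rcases m.eq_zero_or_pos with rfl | hm
  · have ht : t = 0 := by
      by_contra hne
      obtain ⟨i, hi⟩ := Multiset.exists_mem_of_ne_zero hne
      have := hle i (Multiset.mem_map_of_mem _ hi)
      have := i.pos
      omega
    refine ⟨default, ?_⟩
    have : wt (tailMonomial (default : Nat.Partition 0)) = 0 := by
      rw [wt_tailMonomial]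
      have := headD_add_weight (default : Nat.Partition 0)
      omega
    rw [tailMonomial, ht]
    congr 1
    rw [← Multiset.card_eq_zero, Multiset.coe_card, List.length_map, List.length_tail]
    have h2 : (rows (default : Nat.Partition 0)).length = 0 := by
      rw [rows, Multiset.length_sort, Multiset.card_eq_zero]
      exact Subsingleton.elim (default : Nat.Partition 0) (Nat.Partition.mk 0 (by simp) rfl) ▸ rfl
    omega
  · refine ⟨⟨(m - t'.sum) ::ₘ t', ?_, ?_⟩, ?_⟩
    · intro x hx
      rcases Multiset.mem_cons.1 hx with rfl | hx
      · omega
      · exact hpos x hx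
    · rw [Multiset.sum_cons]
      omega
    · rw [tailMonomial]
      congr 1
      rw [rows, Multiset.sort_cons _ _ _ fun b hb => by have := hle b hb; omega, List.tail_cons,
        ← Multiset.map_coe, Multiset.sort_eq, Multiset.map_map]
      refine (Multiset.map_congr rfl fun i _ => ?_).trans (Multiset.map_id t)
      exact PNat.coe_toPNat' i

/-- The monomials of weight at most `d`. -/
abbrev MonomialLE (d : ℕ) : Type := {s : ℕ+ →₀ ℕ // wt s ≤ d}

/-- The partitions of `m` of weight at most `d`. -/
abbrev PartitionLE (m d : ℕ) : Type := {lam : m.Partition // weight lam ≤ d}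

/-- The monomial of a partition of weight at most `d`. -/
def toMonomialLE (m d : ℕ) (lam : PartitionLE m d) : MonomialLE d :=
  ⟨tailMonomial lam.1, by rw [wt_tailMonomial]; exact lam.2⟩

theorem toMonomialLE_injective (m d : ℕ) : Function.Injective (toMonomialLE m d) :=
  fun _ _ h => Subtype.ext (tailMonomial_injective (congrArg Subtype.val h))

theorem toMonomialLE_bijective {m d : ℕ} (h : 2 * d ≤ m) : Function.Bijective (toMonomialLE m d) :=
  ⟨toMonomialLE_injective m d, fun s => by
    obtain ⟨lam, hlam⟩ := exists_tailMonomial_eq h s.2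
    exact ⟨⟨lam, by rw [← wt_tailMonomial, hlam]; exact s.2⟩, Subtype.ext hlam⟩⟩

/-- The monomial `X_d` could only come from `(m - d, d)`, whose first entry would be smaller than
the second. -/
theorem not_surjective_toMonomialLE {m d : ℕ} (h : m < 2 * d) :
    ¬ Function.Surjective (toMonomialLE m d) := by
  intro hsurj
  have hd : 0 < d := by omega
  let i : ℕ+ := ⟨d, hd⟩
  have hi : (i : ℕ) = d := rfl
  obtain ⟨lam, hlam⟩ := hsurj ⟨Finsupp.single i 1, by rw [wt, Finsupp.weight_single]; simp [hi]⟩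
  have h1 : tailMonomial lam.1 = Finsupp.single i 1 := congrArg Subtype.val hlam
  rw [← Multiset.toFinsupp_singleton] at h1
  have h2 := map_coe_toPNat' lam.1
  rw [Multiset.toFinsupp.injective h1] at h2
  have hw : weight lam.1 = d := by
    rw [weight, ← Multiset.sum_coe, ← h2, Multiset.map_singleton, Multiset.sum_singleton, hi]
  have hmem : d ∈ (rows lam.1).tail := by
    rw [← Multiset.mem_coe, ← h2, Multiset.map_singleton, Multiset.mem_singleton, hi]
  have hm : 0 < m := by
    have := headD_add_weight lam.1
    omega
  have hs := rows_sorted lam.1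
  rw [rows_eq_cons lam.1 hm] at hs
  have := (List.pairwise_cons.1 hs).1 d hmem
  omega

instance (d : ℕ) : Finite (MonomialLE d) :=
  Finite.of_surjective _ (toMonomialLE_bijective (le_refl (2 * d))).2

/-- The basis of monomials of `polyLE d`. -/
def basisPolyLE (d : ℕ) : Module.Basis (MonomialLE d) ℚ (polyLE d) :=
  basisRestrictSupport ℚ _

instance (d : ℕ) : FiniteDimensional ℚ (polyLE d) := Module.Finite.of_basis (basisPolyLE d)

theorem finrank_polyLE (d : ℕ) : Module.finrank ℚ (polyLE d) = Nat.card (MonomialLE d) :=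
  Module.finrank_eq_nat_card_basis (basisPolyLE d)

theorem linearIndependent_frobPoly :
    LinearIndependent ℚ (frobPoly : m.Partition → CyclePoly) := by
  refine LinearIndependent.of_comp (rho m).toLinearMap ?_
  have : (rho m).toLinearMap ∘ (frobPoly : m.Partition → CyclePoly) = simpleChar :=
    funext rho_frobPoly
  rw [this]
  exact linearIndependent_simpleChar

/-- Independent elements of `polyLE d`, as numerous as its monomials, span it. -/
theorem span_frobPoly_eq {d : ℕ} (h : 2 * d ≤ m) :
    Submodule.span ℚ (Set.range fun lam : PartitionLE m d => frobPoly lam.1) = polyLE d := by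
  refine Submodule.eq_of_le_of_finrank_le ?_ ?_
  · rw [Submodule.span_le]
    rintro _ ⟨lam, rfl⟩
    exact polyLE_mono lam.2 (frobPoly_mem_polyLE lam.1)
  · have hli : LinearIndependent ℚ fun lam : PartitionLE m d => frobPoly lam.1 :=
      linearIndependent_frobPoly.comp _ Subtype.val_injective
    rw [finrank_span_eq_card hli, finrank_polyLE, ← Nat.card_eq_fintype_card]
    exact (Nat.card_congr (Equiv.ofBijective _ (toMonomialLE_bijective h))).ge

end Counting

/-! ### Scalar products as `m` varies -/

section Stability

variable {m : ℕ}

theorem rho_eq_of_isConj (P : CyclePoly) (g h : Equiv.Perm (Fin m)) (hgh : IsConj g h) :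
    rho m P g = rho m P h := by
  rw [rho_apply, rho_apply, evalCycles, evalCycles]
  simp only [cycleCount, Equiv.Perm.partition_eq_of_isConj.1 hgh]

/-- The coefficient of `y^b` in the product of the power sums at `y₁ = 1`, as a function of the
permutation. -/
def dehomCoeff {n : ℕ} (m : ℕ) (b : Fin n →₀ ℕ) (g : Equiv.Perm (Fin m)) : ℚ :=
  coeff b (dehom n (cycleProd n g))

/-- The product of power sums is homogeneous of degree `m`, so setting `y₁ = 1` hides exactly the
exponent `m - b.degree` of the first letter. -/
theorem dehomCoeff_eq {n : ℕ} (hn : 0 < n) (b : Fin n →₀ ℕ) :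
    dehomCoeff m b = if b ⟨0, hn⟩ = 0 ∧ b.degree ≤ m then
      permChar ⇑(b + Finsupp.single (⟨0, hn⟩ : Fin n) (m - b.degree)) else 0 := by
  split_ifs with h
  · ext g
    have he : eraseZero (b + Finsupp.single (⟨0, hn⟩ : Fin n) (m - b.degree)) = b := by
      ext i
      simp only [eraseZero, Finsupp.equivFunOnFinite_symm_apply_apply, Finsupp.add_apply]
      split_ifs with hi
      · rw [← h.1]
        exact congrArg b (Fin.ext hi.symm)
      · rw [Finsupp.single_eq_of_ne fun e => hi (congrArg Fin.val e), add_zero]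
    have hd : (b + Finsupp.single (⟨0, hn⟩ : Fin n) (m - b.degree)).degree = m := by
      rw [map_add, Finsupp.degree_single]
      omega
    rw [dehomCoeff]
    conv_lhs => rw [← he]
    rw [coeff_dehom_eraseZero (by rw [hd]; exact cycleProd_isHomogeneous g), ← coeff_cycleProd]
    congr 1
    ext i
    rfl
  · ext g
    rw [dehomCoeff, coeff_dehom, Finset.sum_eq_zero]
    · rfl
    · intro e he
      rw [if_neg]
      rintro rfl
      refine h ⟨by simp [eraseZero], ?_⟩
      rw [← degree_of_isHomogeneous (cycleProd_isHomogeneous g) (mem_support_iff.1 he),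
        Finsupp.degree_eq_sum, Finsupp.degree_eq_sum]
      refine Finset.sum_le_sum fun i _ => ?_
      simp only [eraseZero, Finsupp.equivFunOnFinite_symm_apply_apply]
      split_ifs <;> omega

/-- The scalar coefficients come from the discriminant alone and do not involve `m`; this is the
source of stability. -/
theorem rho_frobPoly_eq_sum {M : ℕ} (mu : M.Partition) (hM : m ≤ M) :
    rho m (frobPoly mu) = ∑ p ∈ antidiagonal (frobExponent mu),
      coeff p.1 (dehom _ (∏ i, ∏ j ∈ Ioi i, (X i - X j))) • dehomCoeff m p.2 := by
  ext g
  rw [rho_apply, frobPoly]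
  change (evalCycles g : CyclePoly →+* ℚ) _ = _
  rw [← coeff_map, map_mul, map_prod_powerSumPow mu hM, map_discr, coeff_mul, Finset.sum_apply]
  rfl

theorem degree_le_of_coeff_ne_zero {M : ℕ} (mu : M.Partition) {p}
    (hp : p ∈ antidiagonal (frobExponent mu))
    (h : coeff p.1 (dehom _ (∏ i, ∏ j ∈ Ioi i, (X i - X j))) ≠ 0) :
    p.2.degree ≤ weight mu := by
  -- The discriminant does not involve the `X_i`, so evaluation at any permutation will do, here the
  -- one of `S₀`.
  rw [← map_discr mu (1 : Equiv.Perm (Fin 0)), coeff_map] at h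
  have h1 : discrOrder mu ≤ p.1.degree := by
    by_contra hlt
    exact h (by rw [(discr_excess mu).coeff_eq_zero (not_le.1 hlt), map_zero])
  have h2 := degree_frobExponent mu
  rw [← mem_antidiagonal.1 hp, map_add] at h2
  omega

/-- The first letter occurs `m - b.degree > m - w(λ) = λ₁` times, too often for a column-injective
word. -/
theorem scalarProd_dehomCoeff_eq_zero {n : ℕ} (hn : 0 < n) (b : Fin n →₀ ℕ) (lam : m.Partition)
    (h : b.degree < weight lam) : scalarProd (simpleChar lam) (dehomCoeff m b) = 0 := by
  rw [dehomCoeff_eq hn]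
  split_ifs with hb
  · refine scalarProd_permChar_eq_zero lam _ fun f hf hinj => ?_
    have h1 := hinj.content_le lam ⟨0, hn⟩
    rw [hf] at h1
    simp only [Finsupp.add_apply, Finsupp.single_eq_same] at h1
    have := headD_add_weight lam
    omega
  · rw [← pairing_apply, map_zero]

/-- The words of a given content form one orbit, so the invariants are one-dimensional; here this is
read off from orbit-stabilizer. -/
theorem scalarProd_one_permChar {ι : Type*} [Fintype ι] [DecidableEq ι] (c : ι → ℕ)
    (hc : ∑ i, c i = m) : scalarProd 1 (permChar c : Equiv.Perm (Fin m) → ℚ) = 1 := by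
  have h : ∑ g : Equiv.Perm (Fin m), permChar c g = m.factorial := by
    rw [← sum_card_stabilizer c hc]
    simp_rw [permChar]
    rw [← Nat.cast_sum, Nat.cast_inj]
    simp_rw [Finset.card_filter]
    rw [Finset.sum_comm, Finset.sum_filter]
    refine Finset.sum_congr rfl fun f _ => ?_
    split_ifs with h <;> simp [h]
  simp only [scalarProd, permChar_inv, Pi.one_apply, one_mul]
  rw [h, Fintype.card_perm, Fintype.card_fin, inv_mul_cancel₀]
  exact_mod_cast m.factorial_ne_zero

theorem scalarProd_one_dehomCoeff {n : ℕ} (hn : 0 < n) (b : Fin n →₀ ℕ) (h : b.degree ≤ m) :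
    scalarProd 1 (dehomCoeff m b) = if b ⟨0, hn⟩ = 0 then 1 else 0 := by
  rw [dehomCoeff_eq hn]
  simp only [h, and_true]
  split_ifs with hb
  · refine scalarProd_one_permChar _ ?_
    rw [← Finsupp.degree_eq_sum, map_add, Finsupp.degree_single]
    omega
  · rw [← pairing_apply, map_zero]

theorem scalarProd_rho_eq_zero (P : CyclePoly) (lam : m.Partition) (h : polyWeight P < weight lam) :
    scalarProd (simpleChar lam) (rho m P) = 0 := by
  -- `M ≥ 2 deg P` makes the Frobenius polynomials span, `M ≥ m` makes the truncations harmless in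
  -- `S_m`, and `M > 0` provides a first variable.
  let M := max (2 * polyWeight P + 1) m
  have hP : P ∈ polyLE (polyWeight P) := mem_polyLE_iff_polyWeight_le.2 le_rfl
  rw [← span_frobPoly_eq (m := M) (by omega)] at hP
  suffices hle : Submodule.span ℚ (Set.range fun mu : PartitionLE M (polyWeight P) => frobPoly mu.1)
      ≤ LinearMap.ker (pairing (simpleChar lam) ∘ₗ (rho m).toLinearMap) from hle hP
  rw [Submodule.span_le]
  rintro _ ⟨mu, rfl⟩
  change pairing _ (rho m (frobPoly mu.1)) = 0
  rw [rho_frobPoly_eq_sum mu.1 (le_max_right _ _), map_sum]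
  refine Finset.sum_eq_zero fun p hp => ?_
  rw [map_smul, smul_eq_mul, mul_eq_zero]
  refine or_iff_not_imp_left.2 fun hne => ?_
  refine scalarProd_dehomCoeff_eq_zero (length_pos mu.1 (by omega)) _ lam ?_
  exact (degree_le_of_coeff_ne_zero mu.1 hp hne).trans_lt (mu.2.trans_lt h)

theorem scalarProd_one_rho (P : CyclePoly) (hm : polyWeight P ≤ m) :
    scalarProd 1 (rho m P) = scalarProd 1 (rho (polyWeight P) P) := by
  let d := polyWeight P
  let M := max (2 * d + 1) m
  have hP : P ∈ polyLE d := mem_polyLE_iff_polyWeight_le.2 le_rfl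
  rw [← span_frobPoly_eq (m := M) (by omega)] at hP
  suffices hle : Submodule.span ℚ (Set.range fun mu : PartitionLE M d => frobPoly mu.1)
      ≤ LinearMap.ker (pairing 1 ∘ₗ (rho m).toLinearMap - pairing 1 ∘ₗ (rho d).toLinearMap) from
    sub_eq_zero.1 (hle hP)
  rw [Submodule.span_le]
  rintro _ ⟨mu, rfl⟩
  refine sub_eq_zero.2 ?_
  change pairing _ (rho m (frobPoly mu.1)) = pairing _ (rho d (frobPoly mu.1))
  rw [rho_frobPoly_eq_sum mu.1 (le_max_right _ _), rho_frobPoly_eq_sum mu.1 (show d ≤ M by omega),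
    map_sum, map_sum]
  refine Finset.sum_congr rfl fun p hp => ?_
  rw [map_smul, map_smul, smul_eq_mul, smul_eq_mul, mul_eq_mul_left_iff]
  refine or_iff_not_imp_right.2 fun hne => ?_
  have hb := (degree_le_of_coeff_ne_zero mu.1 hp hne).trans mu.2
  have hl := length_pos mu.1 (by omega)
  rw [pairing_apply, pairing_apply, scalarProd_one_dehomCoeff hl _ hb,
    scalarProd_one_dehomCoeff hl _ (hb.trans hm)]

end Stability

/-! ### The three parts of the theorem -/

section Main

variable {m : ℕ}

theorem range_rhoLE (m d : ℕ) : LinearMap.range (rhoLE m d) =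
    Submodule.span ℚ {f | ∃ lam : m.Partition, weight lam ≤ d ∧ f = simpleChar lam} := by
  refine le_antisymm ?_ ?_
  · rintro _ ⟨P, rfl⟩
    change rho m P.1 ∈ _
    rw [eq_sum_scalarProd_smul (rho_eq_of_isConj P.1)]
    refine Submodule.sum_mem _ fun lam _ => ?_
    rcases le_or_gt (weight lam) d with h | h
    · exact Submodule.smul_mem _ _ (Submodule.subset_span ⟨lam, h, rfl⟩)
    · rw [scalarProd_rho_eq_zero P.1 lam ((mem_polyLE_iff_polyWeight_le.1 P.2).trans_lt h),
        zero_smul]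
      exact zero_mem _
  · rw [Submodule.span_le]
    rintro _ ⟨lam, h, rfl⟩
    exact ⟨⟨frobPoly lam, polyLE_mono h (frobPoly_mem_polyLE lam)⟩, rho_frobPoly lam⟩

/-- By rank-nullity the dimension of the kernel is the number of monomials minus the number of
partitions, so it vanishes exactly when the injection `toMonomialLE` is onto. -/
theorem ker_rhoLE_eq_bot_iff (m d : ℕ) : LinearMap.ker (rhoLE m d) = ⊥ ↔ 2 * d ≤ m := by
  have hset : {f | ∃ lam : m.Partition, weight lam ≤ d ∧ f = simpleChar lam} =
      Set.range fun lam : PartitionLE m d => simpleChar lam.1 := by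
    ext f
    constructor
    · rintro ⟨lam, h, rfl⟩
      exact ⟨⟨lam, h⟩, rfl⟩
    · rintro ⟨lam, rfl⟩
      exact ⟨lam.1, lam.2, rfl⟩
  have hfin : Module.finrank ℚ (LinearMap.range (rhoLE m d)) = Nat.card (PartitionLE m d) := by
    have hli : LinearIndependent ℚ fun lam : PartitionLE m d => simpleChar lam.1 :=
      linearIndependent_simpleChar.comp _ Subtype.val_injective
    rw [range_rhoLE, hset, finrank_span_eq_card hli, Nat.card_eq_fintype_card]
  have hsum := LinearMap.finrank_range_add_finrank_ker (rhoLE m d)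
  rw [hfin, finrank_polyLE] at hsum
  rw [← Submodule.finrank_eq_zero (R := ℚ)]
  constructor
  · intro h
    by_contra hlt
    rw [h, add_zero] at hsum
    exact not_surjective_toMonomialLE (not_le.1 hlt)
      ((toMonomialLE_injective m d).bijective_of_nat_card_le hsum.ge).2
  · intro h
    have := Nat.card_congr (Equiv.ofBijective _ (toMonomialLE_bijective h))
    omega

theorem scalarProd_swap (f F : Equiv.Perm (Fin m) → ℚ) : scalarProd f F = scalarProd F f := by
  rw [scalarProd, scalarProd]
  congr 1
  refine Finset.sum_equiv (Equiv.inv _) (by simp) fun g _ => ?_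
  simp [mul_comm]

theorem mem_supported_of_mem_polyLE {d : ℕ} {P : CyclePoly} (hP : P ∈ polyLE d)
    (hd : d < m ∨ d = 0) : P ∈ supported ℚ {i : ℕ+ | (i : ℕ) < m} := by
  rw [mem_supported]
  intro i hi
  obtain ⟨s, hs, his⟩ := (mem_vars_iff_mem_support i).1 hi
  have h1 : (i : ℕ) ≤ wt s :=
    Finsupp.le_weight_of_ne_zero' (fun i : ℕ+ => (i : ℕ)) (Finsupp.mem_support_iff.1 his)
  have h2 := mem_polyLE.1 hP s hs
  have := i.pos
  change (i : ℕ) < m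
  omega

variable {W : Type u} [AddCommGroup W] [Module ℚ W]
  (r : Representation ℚ (Equiv.Perm (Fin m)) W)

theorem repFrobPoly_mem_polyLE : repFrobPoly r ∈ polyLE (repWeight r) := by
  refine Submodule.sum_mem _ fun lam _ => ?_
  by_cases h : multiplicity r lam = 0
  · simp [h]
  · refine nsmul_mem (polyLE_mono ?_ (frobPoly_mem_polyLE lam)) _
    exact Finset.le_sup (f := weight) (by simpa using h)

theorem repFrobPoly_mem_supported :
    repFrobPoly r ∈ supported ℚ {i : ℕ+ | (i : ℕ) < m} := by
  refine mem_supported_of_mem_polyLE (repFrobPoly_mem_polyLE r) ?_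
  rcases m.eq_zero_or_pos with rfl | hm
  · right
    refine Nat.le_zero.1 (Finset.sup_le fun lam _ => ?_)
    have := headD_add_weight lam
    omega
  · exact Or.inl ((Finset.sup_lt_iff hm).2 fun lam _ => weight_lt lam hm)

variable [FiniteDimensional ℚ W]

theorem scalarProd_simpleChar_character (lam : m.Partition) :
    scalarProd (simpleChar lam) r.character = multiplicity r lam := by
  rw [scalarProd_swap, simpleChar, scalarProd_eq_finrank, multiplicity]

theorem character_eq_sum :
    r.character = ∑ lam : m.Partition, (multiplicity r lam : ℚ) • simpleChar lam := by
  have := eq_sum_scalarProd_smul (F := r.character) fun g h hgh => by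
    obtain ⟨c, rfl⟩ := isConj_iff.1 hgh
    exact (Representation.char_conj r g c).symm
  simpa only [scalarProd_simpleChar_character] using this

theorem repWeight_le_polyWeight {P : CyclePoly} (hP : rho m P = r.character) :
    repWeight r ≤ polyWeight P := by
  refine Finset.sup_le fun lam hlam => ?_
  by_contra h
  have h1 := scalarProd_rho_eq_zero P lam (not_le.1 h)
  rw [hP, scalarProd_simpleChar_character, Nat.cast_eq_zero] at h1
  simp [h1] at hlam

theorem rho_repFrobPoly : rho m (repFrobPoly r) = r.character := by
  rw [character_eq_sum, repFrobPoly, map_sum]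
  refine Finset.sum_congr rfl fun lam _ => ?_
  rw [map_nsmul, rho_frobPoly, Nat.cast_smul_eq_nsmul]

theorem polyWeight_repFrobPoly : polyWeight (repFrobPoly r) = repWeight r :=
  le_antisymm (mem_polyLE_iff_polyWeight_le.1 (repFrobPoly_mem_polyLE r))
    (repWeight_le_polyWeight r (rho_repFrobPoly r))

theorem repFrobPoly_unique_iff :
    (∀ P : CyclePoly, rho m P = r.character → polyWeight P = repWeight r → P = repFrobPoly r) ↔
      2 * repWeight r ≤ m := by
  rw [← ker_rhoLE_eq_bot_iff]
  have hX := repFrobPoly_mem_polyLE r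
  constructor
  · intro huniq
    rw [eq_bot_iff]
    intro K hK
    have hK0 : rho m K.1 = 0 := hK
    -- Adding a kernel element keeps the weight at most `w(W)`, and it cannot drop below because the
    -- values are still those of the character. So uniqueness forces the kernel to vanish.
    have h1 : ∀ t : ℚ, polyWeight (repFrobPoly r + t • K.1) = repWeight r := fun t =>
      le_antisymm (mem_polyLE_iff_polyWeight_le.1 (Submodule.add_mem _ hX
        (Submodule.smul_mem _ _ K.2)))
        (repWeight_le_polyWeight r (by rw [map_add, map_smul, hK0, smul_zero, add_zero,
          rho_repFrobPoly]))
    have h2 := huniq (repFrobPoly r + (1 : ℚ) • K.1)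
      (by rw [map_add, map_smul, hK0, smul_zero, add_zero, rho_repFrobPoly]) (h1 1)
    rw [one_smul, add_eq_left] at h2
    exact Subtype.ext h2
  · intro hker P hP hw
    have hmem : P - repFrobPoly r ∈ polyLE (repWeight r) :=
      Submodule.sub_mem _ (mem_polyLE_iff_polyWeight_le.2 hw.le) hX
    have h1 : (⟨P - repFrobPoly r, hmem⟩ : polyLE (repWeight r)) ∈
        LinearMap.ker (rhoLE m (repWeight r)) := by
      change rho m (P - repFrobPoly r) = 0
      rw [map_sub, hP, rho_repFrobPoly, sub_self]
    rw [hker] at h1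
    exact sub_eq_zero.1 (congrArg Subtype.val h1)

end Main

end SymChar

end

open SymChar in
theorem theorem3p1p1 :
    -- (a) image and kernel of `ρ_m` on the polynomials of weight at most `d`
    (∀ d m : ℕ,
      LinearMap.range (rhoLE m d) =
        Submodule.span ℚ {f | ∃ lam : m.Partition, weight lam ≤ d ∧ f = simpleChar lam} ∧
      (LinearMap.ker (rhoLE m d) = ⊥ ↔ (d : ℚ) ≤ (m : ℚ) / 2)) ∧
    -- (b)
    (∀ P : CyclePoly,
      (∃ c : ℚ, ∀ m : ℕ, polyWeight P ≤ m → scalarProd 1 (rho m P) = c) ∧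
      (∀ (m : ℕ) (lam : m.Partition), polyWeight P < weight lam →
        scalarProd (simpleChar lam) (rho m P) = 0) ∧
      (∀ (m : ℕ) (W : Type u) [AddCommGroup W] [Module ℚ W] [FiniteDimensional ℚ W]
        (r : Representation ℚ (Equiv.Perm (Fin m)) W),
        rho m P = r.character → repWeight r ≤ polyWeight P)) ∧
    -- (c)
    (∀ (m : ℕ) (W : Type u) [AddCommGroup W] [Module ℚ W] [FiniteDimensional ℚ W]
      (r : Representation ℚ (Equiv.Perm (Fin m)) W),
      repFrobPoly r ∈ MvPolynomial.supported ℚ {i : ℕ+ | (i : ℕ) < m} ∧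
      rho m (repFrobPoly r) = r.character ∧
      polyWeight (repFrobPoly r) = repWeight r ∧
      ((∀ P : CyclePoly, rho m P = r.character → polyWeight P = repWeight r →
          P = repFrobPoly r) ↔
        (repWeight r : ℚ) ≤ (m : ℚ) / 2)) := by
  have hhalf : ∀ d m : ℕ, (d : ℚ) ≤ (m : ℚ) / 2 ↔ 2 * d ≤ m := fun d m => by
    rw [le_div_iff₀ two_pos, mul_comm]
    exact_mod_cast Iff.rfl
  refine ⟨fun d m => ⟨range_rhoLE m d, ?_⟩, fun P => ⟨⟨_, fun m => scalarProd_one_rho P⟩,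
    fun m lam => scalarProd_rho_eq_zero P lam, fun m W _ _ _ r => repWeight_le_polyWeight r⟩,
    fun m W _ _ _ r => ⟨repFrobPoly_mem_supported r, rho_repFrobPoly r, polyWeight_repFrobPoly r,
      ?_⟩⟩
  · rw [hhalf, ker_rhoLE_eq_bot_iff]
  · rw [hhalf, repFrobPoly_unique_iff]
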